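/- Let $n\ge 1$ and $0\le k<n$ be integers. Write points of $\mathbb{R}^{2n}$ as $(q_1,\dots,q_n,p_1,\dots,p_n)$, let $J(q,p)=(-p,q)$, and put $$\mathbb{R}^{n,k}=\{(q,p) : p_{k+1}=\dots=p_n=0\},\qquad V_0^{n,k}=\{(q,p) : q_1=\dots=q_k=0,\ p=0\}.$$ Let $K\subset\mathbb{R}^{2n}$ be a convex polytope with $0$ in its interior, let $F_1,\dots,F_N$ be its distinct $(2n-1)$-dimensional facets, and let $n_i$ be the unit outer normal to $F_i$. For $x\in\partial K$ let $N_{\partial K}(x)=\{y : \langle u-x,y\rangle\le 0\ \ \forall u\in K\}$ be the normal cone. A *generalized leafwise chord* (GLC) on $\partial K$ for $\mathbb{R}^{n,k}$ is a nonconstant absolutely continuous curve $z:[0,T]\to\mathbb{R}^{2n}$ (for some $T>0$) with $z([0,T])\subset\partial K$, $\dot z(t)\in J N_{\partial K}(z(t))$ for almost every $t$, $z(0),z(T)\in\mathbb{R}^{n,k}$ and $z(0)-z(T)\in V_0^{n,k}$. Its action is $A(z)=\frac12\int_0^T\langle -J\dot z,z\rangle\,dt$. **Theorem.** There exists a GLC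 $\gamma:[0,1]\to\partial K$ for $\mathbb{R}^{n,k}$ such that $$A(\gamma)=\min\{A(x) : x \text{ is a GLC on } \partial K \text{ for } \mathbb{R}^{n,k}\}$$ and such that the following hold. 1. There are vectors $w_1,\dots,w_m$ and numbers $0=\tau_0<\tau_1<\dots<\tau_m=1$ such that $\dot\gamma(t)=w_j$ for $\tau_{j-1}<t<\tau_j$. For each $j$ there are $i\in\{1,\dots,N\}$ and $C_j>0$ with $w_j=C_jJn_i$, and for each $i$ there is at most one $j$ such that $w_j$ is a positive multiple of $Jn_i$. 2. For each $i$ the set $\{t\in[0,1] : \dot\gamma(t)=CJn_i \text{ for some } C>0\}$ is empty or connected (with one-sided derivatives at $t=0,1$). 3. $\dot\gamma$ has at most $N$ points of discontinuity in $[0,1]$ (points where $\dot\gamma$ does not exist included). 4. $\gamma$ visits the interior of each facet at most once: for each $i$ the set of $t\in[0,1]$ such that $\gamma(t)$ lies in the relative interior of $F_i$ is empty or connected. -/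

import Mathlib

open MeasureTheory Set

noncomputable section

namespace LeafwiseChord

/-- The space `ℝ²ⁿ` with its Euclidean structure. A point is `(q₁, …, qₙ, p₁, …, pₙ)`, where
`qᵢ = x (Sum.inl i)` and `pᵢ = x (Sum.inr i)`; the indices in `Fin n` start at `0`. -/
abbrev PhaseSpace (n : ℕ) : Type := EuclideanSpace ℝ (Fin n ⊕ Fin n)

variable {n : ℕ}

/-- The standard complex structure, given by the block matrix `[[0, -I], [I, 0]]`, that is,
`J (q, p) = (-p, q)`. -/
def cplxJ : PhaseSpace n →ₗ[ℝ] PhaseSpace n :=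
  Matrix.toEuclideanLin (Matrix.J (Fin n) ℝ)

theorem cplxJ_inl (x : PhaseSpace n) (i : Fin n) :
    cplxJ x (Sum.inl i) = -x (Sum.inr i) := by
  simp [cplxJ, Matrix.J, Matrix.fromBlocks_mulVec, Matrix.neg_mulVec, Matrix.toLpLin_apply]

theorem cplxJ_inr (x : PhaseSpace n) (i : Fin n) :
    cplxJ x (Sum.inr i) = x (Sum.inl i) := by
  simp [cplxJ, Matrix.J, Matrix.fromBlocks_mulVec, Matrix.toLpLin_apply]

/-- The coisotropic subspace `ℝ^{n,k} = {(q₁, …, qₙ, p₁, …, p_k, 0, …, 0)}`. -/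
def coisoSubspace (n k : ℕ) : Submodule ℝ (PhaseSpace n) where
  carrier := {x | ∀ i : Fin n, k ≤ (i : ℕ) → x (Sum.inr i) = 0}
  add_mem' := fun hx hy i hi => by simp [hx i hi, hy i hi]
  zero_mem' := fun i _ => by simp
  smul_mem' := fun c x hx i hi => by simp [hx i hi]

/-- The leaf direction `V₀^{n,k} = {(0, …, 0, q_{k+1}, …, qₙ, 0, …, 0)}`. -/
def leafSubspace (n k : ℕ) : Submodule ℝ (PhaseSpace n) where
  carrier := {x | (∀ i : Fin n, (i : ℕ) < k → x (Sum.inl i) = 0) ∧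
    ∀ i : Fin n, x (Sum.inr i) = 0}
  add_mem' := fun hx hy =>
    ⟨fun i hi => by simp [hx.1 i hi, hy.1 i hi], fun i => by simp [hx.2 i, hy.2 i]⟩
  zero_mem' := ⟨fun i _ => by simp, fun i => by simp⟩
  smul_mem' := fun c x hx => ⟨fun i hi => by simp [hx.1 i hi], fun i => by simp [hx.2 i]⟩

/-- The normal cone of `K` at `x`. -/
def normalCone (K : Set (PhaseSpace n)) (x : PhaseSpace n) : Set (PhaseSpace n) :=
  {y | ∀ u ∈ K, inner ℝ (u - x) y ≤ 0}

/-- A convex polytope: a bounded intersection of finitely many closed half-spaces. -/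
def IsConvexPolytope (K : Set (PhaseSpace n)) : Prop :=
  Bornology.IsBounded K ∧
    ∃ (r : ℕ) (a : Fin r → PhaseSpace n) (b : Fin r → ℝ), K = {x | ∀ i, inner ℝ x (a i) ≤ b i}

/-- A facet of `K ⊆ ℝ²ⁿ`: an exposed face of dimension `2n - 1`. -/
def IsFacet (K F : Set (PhaseSpace n)) : Prop :=
  IsExposed ℝ K F ∧ Module.finrank ℝ (vectorSpan ℝ F) + 1 = 2 * n

/-- `ν` is a unit vector that is an outer normal of `K` along `F`. -/
def IsOuterUnitNormal (K F : Set (PhaseSpace n)) (ν : PhaseSpace n) : Prop :=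
  ‖ν‖ = 1 ∧ ∀ x ∈ F, ν ∈ normalCone K x

/-- The action `(1/2) ∫₀ᵀ ⟨-J ż, z⟩ dt` of a path `z` on `[0, T]`. -/
def action (T : ℝ) (z : ℝ → PhaseSpace n) : ℝ :=
  (1 / 2) * ∫ t in (0 : ℝ)..T, inner ℝ (-(cplxJ (deriv z t))) (z t)

/-- `z`, restricted to `[0, T]`, is a generalized leafwise chord on `∂K` for `ℝ^{n,k}`. -/
structure IsGLC (K : Set (PhaseSpace n)) (k : ℕ) (T : ℝ) (z : ℝ → PhaseSpace n) : Prop where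
  pos : 0 < T
  absCont : AbsolutelyContinuousOnInterval z 0 T
  nonconstant : ∃ s ∈ Icc 0 T, ∃ t ∈ Icc 0 T, z s ≠ z t
  mem_boundary : ∀ t ∈ Icc 0 T, z t ∈ frontier K
  velocity : ∀ᵐ t ∂(volume.restrict (Icc 0 T)), ∃ y ∈ normalCone K (z t),
    HasDerivAt z (cplxJ y) t
  start_mem : z 0 ∈ coisoSubspace n k
  end_mem : z T ∈ coisoSubspace n k
  leaf : z 0 - z T ∈ leafSubspace n k

end LeafwiseChord

end

open MeasureTheory Set

noncomputable section

namespace LeafwiseChord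

variable {n : ℕ}

/-! ### The complex structure and the coisotropic subspace. -/

section ComplexStructure

/-! The proof is a finite-dimensional dual action principle. Along a generalized leafwise chord `z`,
the vector `y = -Jż` lies in the normal cone at `z`, so `⟨y, z⟩` is the value at `y` of the support
function of `K`, and `ℓ = 2A(z)` is the length of `z` in that gauge. The leaf condition says that `∫
y` is orthogonal to `E = ℝ^{n,k}`. This suggests maximizing the symplectic area of a finite sequence
of vectors with total in `Eᗮ` and gauge length at most 1; let `M` be the maximum.

Existence and simplicity: each vector can be split into multiples of facet normals without loss of
area (`IsHalfspaceRep.exists_refinement`), and all multiples of one normal can be merged into a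
single piece (`exists_nodup_area_ge`). Only finitely many orders without repetition remain, each
with a compact set of weights, so a maximizer exists that uses every normal at most once
(`IsHalfspaceRep.exists_maximizer`).

From maximizer to chord: the first variation and a Farkas argument yield a translation in `E` that
puts all vertices of the polygon with edges `J v_b` into `2M K` (`exists_multiplier`). Pairing the
vertices with the edge normals and summing gives the largest value possible, so every edge lies in
the facet of its own normal. Scaled by `1/(2M)`, the polygon is a chord of action `1/(4M)`.

Minimality: a fine inscribed polygon of any chord has gauge length at most `ℓ` and area at least `(1
- η)ℓ/2`. The bound `Mℓ²` on that area gives `ℓ ≥ 1/(2M)` as `η → 0` (`IsGLC.le_action`). The four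
structural claims hold because no normal occurs twice. -/

theorem cplxJ_cplxJ (x : PhaseSpace n) : cplxJ (cplxJ x) = -x := by
  ext i
  rcases i with i | i
  · simp [cplxJ_inl, cplxJ_inr]
  · simp [cplxJ_inl, cplxJ_inr]

theorem inner_cplxJ_right (x y : PhaseSpace n) : inner ℝ x (cplxJ y) = -inner ℝ (cplxJ x) y := by
  simp only [PiLp.inner_apply, Fintype.sum_sum_type, cplxJ_inl, cplxJ_inr]
  simp only [RCLike.inner_apply, conj_trivial, mul_neg, neg_mul, Finset.sum_neg_distrib]
  ring

theorem inner_cplxJ_swap (x y : PhaseSpace n) : inner ℝ x (cplxJ y) = -inner ℝ y (cplxJ x) := by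
  rw [inner_cplxJ_right, real_inner_comm]

theorem inner_cplxJ_self (x : PhaseSpace n) : inner ℝ x (cplxJ x) = 0 := by
  have := inner_cplxJ_swap x x
  linarith

theorem inner_cplxJ_cplxJ (x y : PhaseSpace n) : inner ℝ (cplxJ x) (cplxJ y) = inner ℝ x y := by
  rw [inner_cplxJ_right, cplxJ_cplxJ, inner_neg_left, neg_neg]

theorem leafSubspace_le (n k : ℕ) : leafSubspace n k ≤ coisoSubspace n k :=
  fun _ hx i _ => hx.2 i

/-- The leaf direction is the symplectic complement of the coisotropic subspace. This turns the leaf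
condition on a path into a linear constraint on the total of its normals. -/
theorem mem_coisoSubspace_orthogonal_iff {k : ℕ} {y : PhaseSpace n} :
    y ∈ (coisoSubspace n k)ᗮ ↔ cplxJ y ∈ leafSubspace n k := by
  constructor
  · intro hy
    rw [Submodule.mem_orthogonal] at hy
    refine ⟨fun i hi => ?_, fun i => ?_⟩
    · have := hy (EuclideanSpace.single (Sum.inr i) 1) fun j hj => by
        have : j ≠ i := by rintro rfl; omega
        simp [this]
      simpa [cplxJ_inl, EuclideanSpace.inner_single_left] using this
    · have := hy (EuclideanSpace.single (Sum.inl i) 1) fun j hj => by simp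
      simpa [cplxJ_inr, EuclideanSpace.inner_single_left] using this
  · intro hy
    rw [Submodule.mem_orthogonal]
    intro u hu
    simp only [PiLp.inner_apply, Fintype.sum_sum_type]
    have h1 : ∀ i, y (Sum.inl i) = 0 := fun i => by simpa [cplxJ_inr] using hy.2 i
    have h2 : ∀ i : Fin n, y (Sum.inr i) = 0 ∨ u (Sum.inr i) = 0 := fun i => by
      rcases lt_or_ge (i : ℕ) k with h | h
      · exact Or.inl (by simpa [cplxJ_inl] using hy.1 i h)
      · exact Or.inr (hu i h)
    rw [Finset.sum_eq_zero, Finset.sum_eq_zero, add_zero]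
    · intro i _
      rcases h2 i with h | h <;> simp [h]
    · intro i _
      simp [h1 i]

end ComplexStructure

/-! ### Symplectic area of sequences of vectors. -/

section Area

/-- The symplectic area `(1/2) ∑_{a < b} ⟨v_b, J v_a⟩` swept by the polygonal path with successive
velocities `J v_a`. -/
def area : List (PhaseSpace n) → ℝ
  | [] => 0
  | v :: l => area l + (1 / 2) * inner ℝ l.sum (cplxJ v)

@[simp] theorem area_nil : area ([] : List (PhaseSpace n)) = 0 := rfl

theorem area_cons (v : PhaseSpace n) (l : List (PhaseSpace n)) :
    area (v :: l) = area l + (1 / 2) * inner ℝ l.sum (cplxJ v) := rfl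

/-- The cross term sees only the two totals, so a block may be replaced by any block with the same
total and at least the same area. -/
theorem area_append (l₁ l₂ : List (PhaseSpace n)) :
    area (l₁ ++ l₂) = area l₁ + area l₂ + (1 / 2) * inner ℝ l₂.sum (cplxJ l₁.sum) := by
  induction l₁ with
  | nil => simp
  | cons v l ih =>
    simp only [List.cons_append, area_cons, ih, List.sum_append, List.sum_cons, map_add,
      inner_add_left, inner_add_right]
    ring

theorem area_reverse (l : List (PhaseSpace n)) : area l.reverse = -area l := by
  induction l with
  | nil => simp
  | cons v l ih =>
    rw [List.reverse_cons, area_append, ih, area_cons, area_cons, List.sum_reverse]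
    simp only [area_nil, List.sum_nil, inner_zero_left, List.sum_cons, add_zero]
    rw [inner_cplxJ_swap]
    ring

theorem area_smul (c : ℝ) (l : List (PhaseSpace n)) :
    area (l.map (c • ·)) = c ^ 2 * area l := by
  induction l with
  | nil => simp
  | cons v l ih =>
    have : (l.map (c • ·)).sum = c • l.sum := (List.smul_sum).symm
    rw [List.map_cons, area_cons, ih, area_cons, this]
    simp only [map_smul, inner_smul_left, inner_smul_right, conj_trivial]
    ring

theorem area_map_range_succ (v : ℕ → PhaseSpace n) (L : ℕ) :
    area ((List.range (L + 1)).map v) = area ((List.range L).map v) +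
      (1 / 2) * inner ℝ (v L) (cplxJ (∑ a ∈ Finset.range L, v a)) := by
  rw [List.range_succ, List.map_append, area_append]
  have : ((List.range L).map v).sum = ∑ a ∈ Finset.range L, v a := by
    rw [← List.sum_toFinset _ List.nodup_range]; congr 1; ext; simp
  simp [area_cons, this]

theorem area_map_range (v : ℕ → PhaseSpace n) (L : ℕ) :
    area ((List.range L).map v) =
      ∑ b ∈ Finset.range L, (1 / 2) * inner ℝ (v b) (cplxJ (∑ a ∈ Finset.range b, v a)) := by
  induction L with
  | zero => simp
  | succ L ih => rw [area_map_range_succ, ih, Finset.sum_range_succ]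

/-- Two pieces with the same direction can be merged into one without decreasing the area. -/
theorem area_merge (u : PhaseSpace n) {b c : ℝ} (hb : 0 ≤ b) (hc : 0 ≤ c)
    (l₁ l₂ : List (PhaseSpace n)) :
    area (b • u :: (l₁ ++ c • u :: l₂)) ≤ area ((b + c) • u :: (l₁ ++ l₂)) ∨
      area (b • u :: (l₁ ++ c • u :: l₂)) ≤ area (l₁ ++ (b + c) • u :: l₂) := by
  simp only [area_cons, area_append, List.sum_append, List.sum_cons, map_add, map_smul,
    inner_add_left, inner_smul_left, inner_smul_right, conj_trivial, inner_cplxJ_self]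
  rw [inner_cplxJ_swap u l₁.sum]
  -- Moving `c • u` to the front changes the area by `c⟨∑ l₁, Ju⟩`, moving `b • u` back changes it
  -- by `-b⟨∑ l₁, Ju⟩`; one of these is nonnegative.
  by_cases h : 0 ≤ inner ℝ l₁.sum (cplxJ u)
  · left
    nlinarith [mul_nonneg hc h]
  · right
    nlinarith [mul_nonneg hb (neg_nonneg.2 (not_le.1 h).le)]

/-- Any sequence of nonnegative multiples of the vectors `ν i` can be rearranged into one in which
every `i` occurs at most once, with the same total weights and at least the same area. -/
theorem exists_nodup_area_ge {ι : Type*} [DecidableEq ι] (ν : ι → PhaseSpace n) (h : ι → ℝ)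
    (B : List (ι × ℝ)) (hB : ∀ p ∈ B, 0 ≤ p.2) :
    ∃ (l : List ι) (β : ι → ℝ), l.Nodup ∧ (∀ i, 0 ≤ β i) ∧
      (l.map fun i => β i • ν i).sum = (B.map fun p => p.2 • ν p.1).sum ∧
      (l.map fun i => β i * h i).sum = (B.map fun p => p.2 * h p.1).sum ∧
      area (B.map fun p => p.2 • ν p.1) ≤ area (l.map fun i => β i • ν i) := by
  induction B with
  | nil => exact ⟨[], 0, by simp, by simp, by simp, by simp, by simp⟩
  | cons p B ih =>
    obtain ⟨i, b⟩ := p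
    obtain ⟨l, β, hl, hβ, hsum, hh, harea⟩ := ih fun p hp => hB p (List.mem_cons_of_mem _ hp)
    have hb : 0 ≤ b := hB (i, b) List.mem_cons_self
    -- The head interacts only with the total of the tail, which the induction hypothesis preserves.
    have hcons : area (((i, b) :: B).map fun p => p.2 • ν p.1) ≤
        area (b • ν i :: l.map fun i => β i • ν i) := by
      rw [List.map_cons, area_cons, area_cons, hsum]
      linarith
    by_cases hi : i ∈ l
    · obtain ⟨l₁, l₂, rfl⟩ := List.append_of_mem hi
      have hi₁ : ∀ j ∈ l₁, j ≠ i := by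
        rintro j hj rfl
        exact (List.nodup_append.1 hl).2.2 j hj j List.mem_cons_self rfl
      have hi₂ : ∀ j ∈ l₂, j ≠ i := by
        rintro j hj rfl
        exact (List.nodup_cons.1 (List.nodup_append.1 hl).2.1).1 hj
      set β' : ι → ℝ := Function.update β i (b + β i) with hβ'
      have hβ'0 : ∀ j, 0 ≤ β' j := by
        intro j
        by_cases hj : j = i
        · subst hj; simp only [hβ', Function.update_self]; exact add_nonneg hb (hβ j)
        · simp [hβ', Function.update_of_ne hj, hβ j]
      have e : ∀ {M : Type} (f : ι → ℝ → M) (l' : List ι), (∀ j ∈ l', j ≠ i) →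
          (l'.map fun j => f j (β' j)) = l'.map fun j => f j (β j) := by
        intro M f l' hl'
        refine List.map_congr_left fun j hj => ?_
        simp [hβ', Function.update_of_ne (hl' j hj)]
      have e1 := fun l' hl' => e (fun j c => c • ν j) l' hl'
      have e2 := fun l' hl' => e (fun j c => c * h j) l' hl'
      have hβi : β' i = b + β i := by simp [hβ']
      have hnd : (i :: (l₁ ++ l₂)).Nodup := (List.perm_middle.nodup_iff).1 hl
      simp only [List.map_append, List.map_cons, List.sum_append, List.sum_cons] at hsum hh
      have key := area_merge (ν i) hb (hβ i) (l₁.map fun i => β i • ν i)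
        (l₂.map fun i => β i • ν i)
      simp only [List.map_append, List.map_cons] at hcons harea
      rcases key with key | key
      · refine ⟨i :: (l₁ ++ l₂), β', hnd, hβ'0, ?_, ?_, ?_⟩
        · simp only [List.map_append, List.map_cons, List.sum_append, List.sum_cons]
          rw [e1 l₁ hi₁, e1 l₂ hi₂, hβi, ← hsum]
          module
        · simp only [List.map_append, List.map_cons, List.sum_append, List.sum_cons]
          rw [e2 l₁ hi₁, e2 l₂ hi₂, hβi, ← hh]
          ring
        · simp only [List.map_append, List.map_cons]
          rw [e1 l₁ hi₁, e1 l₂ hi₂, hβi]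
          exact hcons.trans key
      · refine ⟨l₁ ++ i :: l₂, β', hl, hβ'0, ?_, ?_, ?_⟩
        · simp only [List.map_append, List.map_cons, List.sum_append, List.sum_cons]
          rw [e1 l₁ hi₁, e1 l₂ hi₂, hβi, ← hsum]
          module
        · simp only [List.map_append, List.map_cons, List.sum_append, List.sum_cons]
          rw [e2 l₁ hi₁, e2 l₂ hi₂, hβi, ← hh]
          ring
        · simp only [List.map_append, List.map_cons]
          rw [e1 l₁ hi₁, e1 l₂ hi₂, hβi]
          exact hcons.trans key
    · set β' : ι → ℝ := Function.update β i b with hβ'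
      have e : ∀ {M : Type} (f : ι → ℝ → M),
          (l.map fun j => f j (β' j)) = l.map fun j => f j (β j) := by
        intro M f
        refine List.map_congr_left fun j hj => ?_
        have : j ≠ i := by rintro rfl; exact hi hj
        simp [hβ', Function.update_of_ne this]
      have hβi : β' i = b := by simp [hβ']
      refine ⟨i :: l, β', List.nodup_cons.2 ⟨hi, hl⟩, ?_, ?_, ?_, ?_⟩
      · intro j
        by_cases hj : j = i
        · subst hj; simpa [hβ'] using hb
        · simp [hβ', Function.update_of_ne hj, hβ j]
      · rw [List.map_cons, List.sum_cons, hβi, e fun j c => c • ν j, hsum]; simp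
      · rw [List.map_cons, List.sum_cons, hβi, e fun j c => c * h j, hh]; simp
      · rw [List.map_cons (f := fun i => β' i • ν i), hβi, e fun j c => c • ν j]
        exact hcons

end Area

/-! ### Facets, normals and the half-space representation. -/

section Facets

theorem exists_pos_smul_mem {K : Set (PhaseSpace n)} (h0 : (0 : PhaseSpace n) ∈ interior K)
    (u : PhaseSpace n) : ∃ c : ℝ, 0 < c ∧ c • u ∈ K := by
  have hK : K ∈ nhds (0 : PhaseSpace n) := mem_interior_iff_mem_nhds.1 h0
  have ht : Filter.Tendsto (fun c : ℝ => c • u) (nhdsWithin 0 (Ioi 0)) (nhds 0) := by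
    have : Filter.Tendsto (fun c : ℝ => c • u) (nhds 0) (nhds ((0 : ℝ) • u)) :=
      (continuous_id.smul continuous_const).tendsto 0
    rw [zero_smul] at this
    exact this.mono_left nhdsWithin_le_nhds
  obtain ⟨c, hc, hc0⟩ := ((ht.eventually hK).and self_mem_nhdsWithin).exists
  exact ⟨c, hc0, hc⟩

theorem exists_mem_inner_pos {K : Set (PhaseSpace n)} (h0 : (0 : PhaseSpace n) ∈ interior K)
    {u : PhaseSpace n} (hu : u ≠ 0) : ∃ x ∈ K, 0 < inner ℝ x u := by
  obtain ⟨c, hc, hcK⟩ := exists_pos_smul_mem h0 u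
  refine ⟨_, hcK, ?_⟩
  rw [inner_smul_left]
  exact mul_pos hc (real_inner_self_pos.2 hu)

variable {K F : Set (PhaseSpace n)} {ν : PhaseSpace n}

theorem IsFacet.nonempty (hF : IsFacet K F) : F.Nonempty := by
  rw [nonempty_iff_ne_empty]
  rintro rfl
  have := hF.2
  rw [vectorSpan_empty, finrank_bot] at this
  omega

theorem IsFacet.subset (hF : IsFacet K F) : F ⊆ K := hF.1.subset

theorem IsOuterUnitNormal.ne_zero (hν : IsOuterUnitNormal K F ν) : ν ≠ 0 := by
  rintro rfl
  simpa using hν.1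

theorem IsOuterUnitNormal.inner_le (hν : IsOuterUnitNormal K F ν) {x y : PhaseSpace n}
    (hx : x ∈ F) (hy : y ∈ K) : inner ℝ y ν ≤ inner ℝ x ν := by
  have := hν.2 x hx y hy
  rw [inner_sub_left] at this
  linarith

theorem IsFacet.inner_eq (hF : IsFacet K F) (hν : IsOuterUnitNormal K F ν) {x y : PhaseSpace n}
    (hx : x ∈ F) (hy : y ∈ F) : inner ℝ x ν = inner ℝ y ν :=
  le_antisymm (hν.inner_le hy (hF.subset hx)) (hν.inner_le hx (hF.subset hy))

/-- A linear form that is constant on a facet is a multiple of the normal of that facet. -/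
theorem IsFacet.exists_eq_smul (hF : IsFacet K F) (hν : IsOuterUnitNormal K F ν)
    {u : PhaseSpace n} (hu : ∀ x ∈ F, ∀ y ∈ F, inner ℝ x u = inner ℝ y u) :
    ∃ c : ℝ, u = c • ν := by
  have key : ∀ v : PhaseSpace n, (∀ x ∈ F, ∀ y ∈ F, inner ℝ x v = inner ℝ y v) →
      v ∈ (vectorSpan ℝ F)ᗮ := by
    intro v hv
    rw [Submodule.mem_orthogonal]
    intro w hw
    induction hw using Submodule.span_induction with
    | mem w hw =>
      obtain ⟨x, hx, y, hy, rfl⟩ := Set.mem_vsub.1 hw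
      rw [vsub_eq_sub, inner_sub_left, hv x hx y hy, sub_self]
    | zero => simp
    | add a b _ _ ha hb => rw [inner_add_left, ha, hb, add_zero]
    | smul c a _ ha => rw [inner_smul_left, ha, mul_zero]
  have hdim : Module.finrank ℝ (vectorSpan ℝ F)ᗮ = 1 := by
    have h1 := Submodule.finrank_add_finrank_orthogonal (vectorSpan ℝ F)
    have h2 : Module.finrank ℝ (PhaseSpace n) = 2 * n := by
      rw [finrank_euclideanSpace, Fintype.card_sum, Fintype.card_fin]; ring
    have := hF.2
    omega
  have hν' := key ν fun x hx y hy => hF.inner_eq hν hx hy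
  obtain ⟨c, hc⟩ := exists_smul_eq_of_finrank_eq_one hdim
    (x := (⟨ν, hν'⟩ : (vectorSpan ℝ F)ᗮ)) (by simpa using hν.ne_zero) ⟨u, key u hu⟩
  exact ⟨c, by simpa using (congrArg Subtype.val hc).symm⟩

theorem IsFacet.inner_pos (h0 : (0 : PhaseSpace n) ∈ interior K)
    (hν : IsOuterUnitNormal K F ν) {x : PhaseSpace n} (hx : x ∈ F) : 0 < inner ℝ x ν := by
  obtain ⟨y, hy, hpos⟩ := exists_mem_inner_pos h0 hν.ne_zero
  exact hpos.trans_le (hν.inner_le hx hy)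

/-- The functional exposing `F` is constant on `F`, hence a multiple of `ν`; so `F` is the whole
face of `K` on which `ν` is maximal. -/
theorem IsFacet.mem_iff (hF : IsFacet K F)
    (hν : IsOuterUnitNormal K F ν) {x y : PhaseSpace n} (hx : x ∈ F) :
    y ∈ F ↔ y ∈ K ∧ inner ℝ y ν = inner ℝ x ν := by
  refine ⟨fun hy => ⟨hF.subset hy, hF.inner_eq hν hy hx⟩, fun ⟨hyK, hy⟩ => ?_⟩
  obtain ⟨l, hl⟩ := hF.1 (hF.nonempty)
  set f := (InnerProductSpace.toDual ℝ (PhaseSpace n)).symm l with hf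
  have hlf : ∀ z, l z = inner ℝ z f := fun z => by
    rw [real_inner_comm, hf, InnerProductSpace.toDual_symm_apply]
  have hmem : ∀ z, z ∈ F ↔ z ∈ K ∧ ∀ w ∈ K, l w ≤ l z := fun z => by
    conv_lhs => rw [hl]
    rfl
  obtain ⟨c, hc⟩ := hF.exists_eq_smul hν (u := f) fun a ha b hb => by
    rw [← hlf, ← hlf]
    exact le_antisymm (((hmem b).1 hb).2 a (hF.subset ha)) (((hmem a).1 ha).2 b (hF.subset hb))
  rw [hmem]
  refine ⟨hyK, fun w hw => ?_⟩
  have := ((hmem x).1 hx).2 w hw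
  rw [hlf, hlf, hc, inner_smul_right, inner_smul_right] at this ⊢
  rwa [hy]

/-- `K` is the bounded intersection of the half-spaces `⟨x, ν i⟩ ≤ h i`, with `h i > 0`. -/
structure IsHalfspaceRep {ι : Type*} (K : Set (PhaseSpace n)) (ν : ι → PhaseSpace n)
    (h : ι → ℝ) : Prop where
  bounded : Bornology.IsBounded K
  pos : ∀ i, 0 < h i
  mem_iff : ∀ x, x ∈ K ↔ ∀ i, inner ℝ x (ν i) ≤ h i

/-- `G` lies in a hyperplane and contains a short step from `p` in each direction of it, so its
differences span exactly the orthogonal complement of `a`. -/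
theorem finrank_vectorSpan_of_hyperplane {G : Set (PhaseSpace n)} {a p : PhaseSpace n} {b : ℝ}
    (ha : a ≠ 0) (hG : ∀ x ∈ G, inner ℝ x a = b)
    (hp : ∀ v : PhaseSpace n, inner ℝ v a = 0 → ∃ ε : ℝ, 0 < ε ∧ p + ε • v ∈ G) :
    Module.finrank ℝ (vectorSpan ℝ G) + 1 = 2 * n := by
  have hspan : vectorSpan ℝ G = (Submodule.span ℝ {a})ᗮ := by
    apply le_antisymm
    · rw [vectorSpan, Submodule.span_le]
      rintro _ ⟨x, hx, y, hy, rfl⟩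
      rw [SetLike.mem_coe, Submodule.mem_orthogonal_singleton_iff_inner_left]
      change inner ℝ (x - y) a = 0
      rw [inner_sub_left, hG x hx, hG y hy, sub_self]
    · intro v hv
      rw [Submodule.mem_orthogonal_singleton_iff_inner_left] at hv
      obtain ⟨ε, hε, hεG⟩ := hp v hv
      obtain ⟨δ, hδ, hδG⟩ := hp 0 (by simp)
      have := vsub_mem_vectorSpan ℝ hεG hδG
      rw [smul_zero, add_zero, vsub_eq_sub, add_sub_cancel_left] at this
      exact (Submodule.smul_mem_iff _ hε.ne').1 this
  have h1 := Submodule.finrank_add_finrank_orthogonal (Submodule.span ℝ {a})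
  have h2 : Module.finrank ℝ (PhaseSpace n) = 2 * n := by
    rw [finrank_euclideanSpace, Fintype.card_sum, Fintype.card_fin]; ring
  rw [finrank_span_singleton ha] at h1
  rw [hspan]
  omega

/-- In a minimal representation of a polytope by half-spaces every half-space cuts out a facet. -/
theorem IsConvexPolytope.exists_facets (hK : IsConvexPolytope K)
    (h0 : (0 : PhaseSpace n) ∈ interior K) :
    ∃ (ι : Type) (a : ι → PhaseSpace n) (b : ι → ℝ), (∀ x, x ∈ K ↔ ∀ i, inner ℝ x (a i) ≤ b i) ∧
      ∀ i, 0 < b i ∧ IsFacet K {x ∈ K | inner ℝ x (a i) = b i} := by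
  obtain ⟨-, r, a, b, hab⟩ := hK
  -- An irredundant subfamily of the given half-spaces.
  obtain ⟨S, hS⟩ := exists_minimal_of_wellFoundedLT
    (fun S : Finset (Fin r) => ∀ x, (∀ i ∈ S, inner ℝ x (a i) ≤ b i) → x ∈ K)
    ⟨Finset.univ, fun x hx => by rw [hab]; exact fun i => hx i (Finset.mem_univ i)⟩
  have hb : ∀ i, a i ≠ 0 → 0 < b i := by
    intro i hi
    obtain ⟨x, hx, hpos⟩ := exists_mem_inner_pos h0 hi
    rw [hab] at hx
    exact hpos.trans_le (hx i)
  have hb0 : ∀ i, 0 ≤ b i := by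
    intro i
    have := interior_subset h0
    rw [hab] at this
    simpa using this i
  -- By minimality, dropping the `i`-th inequality admits a point that violates this inequality
  -- alone.
  have hw : ∀ i ∈ S, ∃ x, (∀ j ∈ S, j ≠ i → inner ℝ x (a j) ≤ b j) ∧ b i < inner ℝ x (a i) := by
    intro i hi
    by_contra! hcon
    have := hS.2 (y := S.erase i) (fun x hx => hS.1 x fun j hj => ?_) (Finset.erase_subset i S)
    · exact absurd (this hi) (Finset.notMem_erase i S)
    · by_cases hji : j = i
      · subst hji
        exact hcon x fun j' hj' hne => hx j' (Finset.mem_erase.2 ⟨hne, hj'⟩)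
      · exact hx j (Finset.mem_erase.2 ⟨hji, hj⟩)
  have hne : ∀ i ∈ S, a i ≠ 0 := by
    intro i hi h
    obtain ⟨x, -, hx⟩ := hw i hi
    rw [h, inner_zero_right] at hx
    exact absurd hx (hb0 i).not_gt
  refine ⟨S, fun i => a i, fun i => b i, fun x => ⟨fun hx i => ?_, fun hx => ?_⟩, fun ⟨i, hi⟩ => ?_⟩
  · rw [hab] at hx
    exact hx i
  · exact hS.1 x fun i hi => hx ⟨i, hi⟩
  · have hbi := hb i (hne i hi)
    refine ⟨hbi, ?_⟩
    obtain ⟨x, hx, hxi⟩ := hw i hi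
    have hxi0 := hbi.trans hxi
    -- Shrinking `x` towards 0 until it meets the `i`-th hyperplane makes all other inequalities
    -- strict, since `t < 1` and `b j > 0`. The result is a relative interior point of the facet.
    set t := b i / inner ℝ x (a i) with ht
    have ht0 : 0 < t := div_pos hbi hxi0
    have ht1 : t < 1 := (div_lt_one hxi0).2 hxi
    have hpi : inner ℝ (t • x) (a i) = b i := by
      rw [inner_smul_left, ht]
      exact div_mul_cancel₀ _ hxi0.ne'
    have hpj : ∀ j ∈ S, j ≠ i → inner ℝ (t • x) (a j) < b j := by
      intro j hj hji
      have h1 := hx j hj hji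
      have h2 := hb j (hne j hj)
      rw [inner_smul_left]
      simp only [conj_trivial]
      nlinarith
    have hev : ∀ v : PhaseSpace n, inner ℝ v (a i) = 0 →
        ∃ ε : ℝ, 0 < ε ∧ t • x + ε • v ∈ {y ∈ K | inner ℝ y (a i) = b i} := by
      intro v hv
      have hv' : ∀ ε : ℝ, inner ℝ (t • x + ε • v) (a i) = b i := fun ε => by
        rw [inner_add_left, hpi, inner_smul_left, hv, mul_zero, add_zero]
      have : ∀ᶠ ε : ℝ in nhdsWithin 0 (Ioi 0), ∀ j ∈ S, j ≠ i →
          inner ℝ (t • x + ε • v) (a j) < b j := by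
        refine Filter.Eventually.filter_mono nhdsWithin_le_nhds ?_
        rw [Filter.eventually_all_finset]
        intro j hj
        by_cases hji : j = i
        · simp [hji]
        · have hc : Continuous fun ε : ℝ => inner ℝ (t • x + ε • v) (a j) := by fun_prop
          have := hc.continuousAt.eventually_lt (x₀ := (0 : ℝ)) continuousAt_const
            (by simpa using hpj j hj hji)
          exact this.mono fun ε hε _ => hε
      obtain ⟨ε, hε, hε0⟩ := (this.and self_mem_nhdsWithin).exists
      refine ⟨ε, hε0, hS.1 _ fun j hj => ?_, hv' ε⟩
      by_cases hji : j = i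
      · exact (hji ▸ hv' ε).le
      · exact (hε j hj hji).le
    refine ⟨fun _ => ⟨innerSL ℝ (a i), ?_⟩, ?_⟩
    · obtain ⟨ε, -, hpK, -⟩ := hev 0 (by simp)
      rw [smul_zero, add_zero] at hpK
      ext y
      simp only [mem_ofPred_eq, innerSL_apply_apply, real_inner_comm _ (a i)]
      refine and_congr_right fun hy => ⟨fun h z hz => ?_, fun h => ?_⟩
      · rw [hab] at hz
        exact (hz i).trans h.ge
      · rw [hab] at hy
        exact le_antisymm (hy i) (hpi ▸ h _ hpK)
    · exact finrank_vectorSpan_of_hyperplane (hne i hi) (fun y hy => hy.2) hev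

variable {N : ℕ} {F : Fin N → Set (PhaseSpace n)} {ν : Fin N → PhaseSpace n}

/-- A polytope is the intersection of the half-spaces of its facets. -/
theorem exists_isHalfspaceRep (hK : IsConvexPolytope K)
    (h0 : (0 : PhaseSpace n) ∈ interior K) (hF : ∀ G, IsFacet K G ↔ ∃ i, F i = G)
    (hν : ∀ i, IsOuterUnitNormal K (F i) (ν i)) :
    ∃ h : Fin N → ℝ, IsHalfspaceRep K ν h ∧ ∀ i y, y ∈ F i ↔ y ∈ K ∧ inner ℝ y (ν i) = h i := by
  have hFi : ∀ i, IsFacet K (F i) := fun i => (hF _).2 ⟨i, rfl⟩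
  choose x hx using fun i => (hFi i).nonempty
  have hmem : ∀ i y, y ∈ F i ↔ y ∈ K ∧ inner ℝ y (ν i) = inner ℝ (x i) (ν i) :=
    fun i y => (hFi i).mem_iff (hν i) (hx i)
  refine ⟨fun i => inner ℝ (x i) (ν i), ⟨hK.1, fun i => IsFacet.inner_pos h0 (hν i) (hx i),
    fun y => ⟨fun hy i => (hν i).inner_le (hx i) hy, fun hy => ?_⟩⟩, hmem⟩
  obtain ⟨ι, a, b, hab, hfac⟩ := hK.exists_facets h0
  rw [hab]
  intro j
  obtain ⟨hbj, hfacet⟩ := hfac j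
  obtain ⟨i, hi⟩ := (hF _).1 hfacet
  have hxa : ∀ z ∈ F i, inner ℝ z (a j) = b j := fun z hz => by rw [hi] at hz; exact hz.2
  obtain ⟨c, hc⟩ := (hFi i).exists_eq_smul (hν i) (u := a j)
    fun z hz w hw => (hxa z hz).trans (hxa w hw).symm
  have h1 := hxa _ (hx i)
  have h2 := IsFacet.inner_pos h0 (hν i) (hx i)
  rw [hc, inner_smul_right] at h1 ⊢
  have hcpos : 0 < c := by
    by_contra! hle
    nlinarith
  rw [← h1]
  exact mul_le_mul_of_nonneg_left (hy i) hcpos.le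

/-- The two normals are proportional; positive support values make the factor positive and unit
length makes it 1, so both facets are the same face. -/
theorem eq_of_inner_eq_on_facet {h : Fin N → ℝ} (hFinj : Function.Injective F)
    (hrep : IsHalfspaceRep K ν h) (hFi : ∀ i, IsFacet K (F i))
    (hν : ∀ i, IsOuterUnitNormal K (F i) (ν i))
    (hmem : ∀ i y, y ∈ F i ↔ y ∈ K ∧ inner ℝ y (ν i) = h i) {i l : Fin N}
    (hl : ∀ y ∈ F i, inner ℝ y (ν l) = h l) : l = i := by
  obtain ⟨c, hc⟩ := (hFi i).exists_eq_smul (hν i) (u := ν l)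
    fun z hz w hw => (hl z hz).trans (hl w hw).symm
  obtain ⟨x, hx⟩ := (hFi i).nonempty
  have h1 := hl x hx
  rw [hc, inner_smul_right, ((hmem i x).1 hx).2] at h1
  have hpi := hrep.pos i
  have hpl := hrep.pos l
  have hcpos : 0 < c := by
    by_contra! hle
    nlinarith
  have hc1 : c = 1 := by
    have := congrArg norm hc
    rw [norm_smul, (hν i).1, (hν l).1, Real.norm_of_nonneg hcpos.le] at this
    linarith
  rw [hc1, one_smul] at hc
  rw [hc1, one_mul] at h1
  apply hFinj
  ext y
  rw [hmem, hmem, hc, h1]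

theorem injective_normal {h : Fin N → ℝ} (hFinj : Function.Injective F)
    (hrep : IsHalfspaceRep K ν h) (hFi : ∀ i, IsFacet K (F i))
    (hν : ∀ i, IsOuterUnitNormal K (F i) (ν i))
    (hmem : ∀ i y, y ∈ F i ↔ y ∈ K ∧ inner ℝ y (ν i) = h i) : Function.Injective ν := by
  intro l i hli
  refine eq_of_inner_eq_on_facet hFinj hrep hFi hν hmem fun y hy => ?_
  obtain ⟨hyK, hy'⟩ := (hmem i y).1 hy
  obtain ⟨x, hx⟩ := (hFi l).nonempty
  obtain ⟨hxK, hx'⟩ := (hmem l x).1 hx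
  refine le_antisymm ((hrep.mem_iff y).1 hyK l) ?_
  rw [← hx', hli, hy']
  exact (hrep.mem_iff x).1 hxK i

/-- The relative interior of a facet is cut out by the strict inequalities of the others. -/
theorem mem_intrinsicInterior_facet_iff {h : Fin N → ℝ} (hFinj : Function.Injective F)
    (hrep : IsHalfspaceRep K ν h) (hFi : ∀ i, IsFacet K (F i))
    (hν : ∀ i, IsOuterUnitNormal K (F i) (ν i))
    (hmem : ∀ i y, y ∈ F i ↔ y ∈ K ∧ inner ℝ y (ν i) = h i) (i : Fin N) (x : PhaseSpace n) :
    x ∈ intrinsicInterior ℝ (F i) ↔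
      inner ℝ x (ν i) = h i ∧ ∀ l, l ≠ i → inner ℝ x (ν l) < h l := by
  constructor
  · intro hx
    have hxF := intrinsicInterior_subset hx
    have hxK := ((hmem i x).1 hxF).1
    refine ⟨((hmem i x).1 hxF).2, fun l hl => lt_of_le_of_ne ((hrep.mem_iff x).1 hxK l) ?_⟩
    intro heq
    refine hl (eq_of_inner_eq_on_facet hFinj hrep hFi hν hmem fun y hy => ?_)
    obtain ⟨z, hz, rfl⟩ := mem_intrinsicInterior.1 hx
    obtain ⟨U, hUsub, hU, hzU⟩ := mem_interior.1 hz
    obtain ⟨U', hU', rfl⟩ := isOpen_induced_iff.1 hU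
    have hc : Continuous fun s : ℝ => AffineMap.lineMap (z : PhaseSpace n) y s :=
      AffineMap.lineMap_continuous
    -- Negative `s` prolongs the segment from `y` beyond `z` inside the facet. As the `l`-th
    -- inequality is an equality at `z`, slack at `y` would violate it there.
    have hev : ∀ᶠ s : ℝ in nhdsWithin 0 (Iio 0), AffineMap.lineMap (z : PhaseSpace n) y s ∈ U' := by
      refine Filter.Eventually.filter_mono nhdsWithin_le_nhds ?_
      refine hc.continuousAt.eventually (hU'.mem_nhds ?_)
      simpa using hzU
    obtain ⟨s, hs, hs0⟩ := (hev.and self_mem_nhdsWithin).exists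
    have hmemF : AffineMap.lineMap (z : PhaseSpace n) y s ∈ F i := by
      have hsp : AffineMap.lineMap (z : PhaseSpace n) y s ∈ affineSpan ℝ (F i) :=
        AffineMap.lineMap_mem s z.2 (subset_affineSpan ℝ _ hy)
      exact hUsub (show (⟨_, hsp⟩ : affineSpan ℝ (F i)) ∈ _ from hs)
    have h1 := (hrep.mem_iff _).1 ((hFi i).subset hmemF) l
    have h2 := (hrep.mem_iff _).1 ((hFi i).subset hy) l
    rw [AffineMap.lineMap_apply_module, inner_add_left, inner_smul_left, inner_smul_left, heq] at h1
    simp only [conj_trivial] at h1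
    have hs0' : s < 0 := hs0
    nlinarith
  · rintro ⟨hxi, hxl⟩
    have hxF : x ∈ F i := (hmem i x).2 ⟨(hrep.mem_iff x).2 fun l => by
      by_cases hl : l = i
      · rw [hl, hxi]
      · exact (hxl l hl).le, hxi⟩
    refine mem_intrinsicInterior.2 ⟨⟨x, subset_affineSpan ℝ _ hxF⟩, ?_, rfl⟩
    rw [mem_interior]
    refine ⟨((↑) : affineSpan ℝ (F i) → PhaseSpace n) ⁻¹'
      {y : PhaseSpace n | ∀ l, l ≠ i → inner ℝ y (ν l) < h l}, ?_, ?_, hxl⟩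
    · rintro ⟨y, hyspan⟩ hy
      have hyi : inner ℝ y (ν i) = h i := by
        have hv := AffineSubspace.vsub_mem_direction hyspan (subset_affineSpan ℝ _ hxF)
        rw [direction_affineSpan] at hv
        have : y -ᵥ x ∈ (Submodule.span ℝ {ν i})ᗮ := by
          refine (?_ : vectorSpan ℝ (F i) ≤ _) hv
          rw [vectorSpan, Submodule.span_le]
          rintro _ ⟨a, ha, b, hb, rfl⟩
          rw [SetLike.mem_coe, Submodule.mem_orthogonal_singleton_iff_inner_left]
          change inner ℝ (a - b) (ν i) = 0
          rw [inner_sub_left, ((hmem i a).1 ha).2, ((hmem i b).1 hb).2, sub_self]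
        rw [Submodule.mem_orthogonal_singleton_iff_inner_left, vsub_eq_sub, inner_sub_left] at this
        linarith
      refine (hmem i y).2 ⟨(hrep.mem_iff y).2 fun l => ?_, hyi⟩
      by_cases hl : l = i
      · rw [hl, hyi]
      · exact (hy l hl).le
    · refine IsOpen.preimage continuous_subtype_val ?_
      simp only [ofPred_forall]
      refine isOpen_iInter_of_finite fun l => isOpen_iInter_of_finite fun _ => ?_
      exact isOpen_lt (by fun_prop) continuous_const

end Facets

/-! ### Splitting vectors into multiples of normals. -/

section Decomposition

variable {ι : Type*} [Fintype ι] {K : Set (PhaseSpace n)} {ν : ι → PhaseSpace n} {h : ι → ℝ}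

theorem isCompact_weights (hh : ∀ i, 0 < h i) (c : ℝ) :
    IsCompact {β : ι → ℝ | (∀ i, 0 ≤ β i) ∧ ∑ i, β i * h i ≤ c} := by
  refine (isCompact_Icc (a := (0 : ι → ℝ)) (b := fun i => c / h i)).of_isClosed_subset ?_ ?_
  · refine IsClosed.inter (s₁ := {β : ι → ℝ | ∀ i, 0 ≤ β i})
      (s₂ := {β : ι → ℝ | ∑ i, β i * h i ≤ c}) ?_ ?_
    · simp only [ofPred_forall]
      exact isClosed_iInter fun i => isClosed_le continuous_const (continuous_apply i)
    · exact isClosed_le (by fun_prop) continuous_const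
  · rintro β ⟨hβ, hβc⟩
    refine ⟨hβ, fun i => ?_⟩
    rw [le_div_iff₀ (hh i)]
    exact (Finset.single_le_sum (f := fun i => β i * h i)
      (fun j _ => mul_nonneg (hβ j) (hh j).le) (Finset.mem_univ i)).trans hβc

/-- A vector whose support function is at most `c` is a nonnegative combination of the normals,
of total weight at most `c`. -/
theorem IsHalfspaceRep.exists_decomposition (hrep : IsHalfspaceRep K ν h)
    (h0 : (0 : PhaseSpace n) ∈ interior K) {v : PhaseSpace n} {c : ℝ}
    (hv : ∀ x ∈ K, inner ℝ x v ≤ c) :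
    ∃ β : ι → ℝ, (∀ i, 0 ≤ β i) ∧ ∑ i, β i • ν i = v ∧ ∑ i, β i * h i ≤ c := by
  have hc0 : 0 ≤ c := by simpa using hv 0 (interior_subset h0)
  rcases hc0.eq_or_lt with rfl | hc
  · have : v = 0 := by
      by_contra hne
      obtain ⟨x, hx, hpos⟩ := exists_mem_inner_pos h0 hne
      exact absurd (hv x hx) hpos.not_ge
    exact ⟨0, by simp, by simp [this], by simp⟩
  have hcpt : IsCompact ((fun β : ι → ℝ => ∑ i, β i • ν i) ''
      {β | (∀ i, 0 ≤ β i) ∧ ∑ i, β i * h i ≤ c}) :=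
    (isCompact_weights hrep.pos c).image (by fun_prop)
  have hconv : Convex ℝ ((fun β : ι → ℝ => ∑ i, β i • ν i) ''
      {β | (∀ i, 0 ≤ β i) ∧ ∑ i, β i * h i ≤ c}) := by
    refine Convex.is_linear_image ?_ (f := fun β : ι → ℝ => ∑ i, β i • ν i) ⟨?_, ?_⟩
    · rintro β ⟨hβ, hβc⟩ β' ⟨hβ', hβc'⟩ s t hs ht hst
      refine ⟨fun i => ?_, ?_⟩
      · have := hβ i
        have := hβ' i
        simp only [Pi.add_apply, Pi.smul_apply, smul_eq_mul]
        positivity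
      · have : ∑ i, (s • β + t • β') i * h i = s * ∑ i, β i * h i + t * ∑ i, β' i * h i := by
          simp only [Pi.add_apply, Pi.smul_apply, smul_eq_mul, Finset.mul_sum,
            ← Finset.sum_add_distrib]
          exact Finset.sum_congr rfl fun i _ => by ring
        rw [this]
        calc _ ≤ s * c + t * c := by gcongr
          _ = c := by rw [← add_mul, hst, one_mul]
    · intro β β'
      simp [add_smul, Finset.sum_add_distrib]
    · intro r β
      simp [mul_smul, Finset.smul_sum]
  by_contra hcon
  have hnot : v ∉ (fun β : ι → ℝ => ∑ i, β i • ν i) ''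
      {β | (∀ i, 0 ≤ β i) ∧ ∑ i, β i * h i ≤ c} := by
    rintro ⟨β, ⟨hβ, hβc⟩, hβv⟩
    exact hcon ⟨β, hβ, hβv, hβc⟩
  obtain ⟨f, u, hf1, hf2⟩ := geometric_hahn_banach_closed_point hconv hcpt.isClosed hnot
  have hu : 0 < u := by
    simpa using hf1 0 ⟨0, ⟨by simp, by simpa using hc.le⟩, by simp⟩
  set y := (InnerProductSpace.toDual ℝ (PhaseSpace n)).symm f with hy
  have hfy : ∀ z, f z = inner ℝ y z := fun z => by
    rw [hy, InnerProductSpace.toDual_symm_apply]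
  -- The separating functional, suitably scaled, is a point of `K`: testing it on `(c / h i) • ν i`
  -- gives the `i`-th inequality. Its pairing with `v` then exceeds `c`.
  have hyK : (c / u) • y ∈ K := by
    classical
    rw [hrep.mem_iff]
    intro i
    have hi := hrep.pos i
    have := hf1 ((c / h i) • ν i) ⟨Pi.single i (c / h i), ⟨fun j => ?_, ?_⟩, ?_⟩
    · rw [map_smul, hfy, smul_eq_mul, div_mul_eq_mul_div, div_lt_iff₀ hi] at this
      rw [inner_smul_left]
      simp only [conj_trivial]
      rw [div_mul_eq_mul_div, div_le_iff₀ hu]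
      linarith
    · by_cases hj : j = i
      · subst hj; rw [Pi.single_eq_same]; positivity
      · rw [Pi.single_eq_of_ne hj]
    · rw [Finset.sum_eq_single i (fun j _ hj => by simp [hj]) (by simp), Pi.single_eq_same,
        div_mul_cancel₀ _ hi.ne']
    · change ∑ j, _ = _
      rw [Finset.sum_eq_single i (fun j _ hj => by simp [hj]) (by simp), Pi.single_eq_same]
  have h1 := hv _ hyK
  rw [inner_smul_left, ← hfy] at h1
  simp only [conj_trivial] at h1
  rw [div_mul_eq_mul_div, div_le_iff₀ hu] at h1
  nlinarith

/-- The decomposition of a vector into normals can be ordered so that its area is nonnegative. -/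
theorem IsHalfspaceRep.exists_list_decomposition (hrep : IsHalfspaceRep K ν h)
    (h0 : (0 : PhaseSpace n) ∈ interior K) {v : PhaseSpace n} {c : ℝ}
    (hv : ∀ x ∈ K, inner ℝ x v ≤ c) :
    ∃ B : List (ι × ℝ), (∀ p ∈ B, 0 ≤ p.2) ∧ (B.map fun p => p.2 • ν p.1).sum = v ∧
      (B.map fun p => p.2 * h p.1).sum ≤ c ∧ 0 ≤ area (B.map fun p => p.2 • ν p.1) := by
  obtain ⟨β, hβ, hsum, hcost⟩ := hrep.exists_decomposition h0 hv
  set B : List (ι × ℝ) := Finset.univ.toList.map fun i => (i, β i) with hB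
  have hB0 : ∀ p ∈ B, 0 ≤ p.2 := by
    simp only [hB, List.mem_map]
    rintro _ ⟨i, -, rfl⟩
    exact hβ i
  have hBs : (B.map fun p => p.2 • ν p.1).sum = v := by
    rw [hB, List.map_map, ← hsum, ← Finset.sum_map_toList]; rfl
  have hBc : (B.map fun p => p.2 * h p.1).sum ≤ c := by
    rw [hB, List.map_map]
    refine le_trans (le_of_eq ?_) hcost
    rw [← Finset.sum_map_toList]; rfl
  rcases le_total 0 (area (B.map fun p => p.2 • ν p.1)) with hA | hA
  · exact ⟨B, hB0, hBs, hBc, hA⟩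
  · refine ⟨B.reverse, fun p hp => hB0 p (List.mem_reverse.1 hp), ?_, ?_, ?_⟩
    · rw [List.map_reverse, List.sum_reverse, hBs]
    · rwa [List.map_reverse, List.sum_reverse]
    · rw [List.map_reverse, area_reverse]
      linarith

/-- Refinement of a sequence of vectors into multiples of the normals. -/
theorem IsHalfspaceRep.exists_refinement (hrep : IsHalfspaceRep K ν h)
    (h0 : (0 : PhaseSpace n) ∈ interior K) (l : List (PhaseSpace n × ℝ))
    (hl : ∀ p ∈ l, ∀ x ∈ K, inner ℝ x p.1 ≤ p.2) :
    ∃ B : List (ι × ℝ), (∀ p ∈ B, 0 ≤ p.2) ∧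
      (B.map fun p => p.2 • ν p.1).sum = (l.map Prod.fst).sum ∧
      (B.map fun p => p.2 * h p.1).sum ≤ (l.map Prod.snd).sum ∧
      area (l.map Prod.fst) ≤ area (B.map fun p => p.2 • ν p.1) := by
  induction l with
  | nil => exact ⟨[], by simp, by simp, by simp, by simp⟩
  | cons p l ih =>
    obtain ⟨B, hB, hs, hc, hA⟩ := ih fun q hq => hl q (List.mem_cons_of_mem _ hq)
    obtain ⟨B', hB', hs', hc', hA'⟩ :=
      hrep.exists_list_decomposition h0 (hl p List.mem_cons_self)
    refine ⟨B' ++ B, ?_, ?_, ?_, ?_⟩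
    · intro q hq
      rcases List.mem_append.1 hq with h | h
      exacts [hB' q h, hB q h]
    · simp [hs, hs']
    · simp only [List.map_append, List.sum_append, List.map_cons, List.sum_cons]
      linarith
    -- The cross term is unchanged because the totals agree, and the block replacing the head has
    -- nonnegative area of its own.
    · rw [List.map_append, area_append, hs, hs', List.map_cons, area_cons]
      linarith

end Decomposition

/-! ### The maximal area. -/

section Maximum

variable {ι : Type*} {K : Set (PhaseSpace n)} {ν : ι → PhaseSpace n} {h : ι → ℝ}

theorem continuous_sum_map_smul (ν : ι → PhaseSpace n) (l : List ι) :
    Continuous fun β : ι → ℝ => (l.map fun i => β i • ν i).sum := by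
  induction l with
  | nil => simpa using continuous_const
  | cons i l ih =>
    simp only [List.map_cons, List.sum_cons]
    exact (by fun_prop : Continuous fun β : ι → ℝ => β i • ν i).add ih

theorem continuous_cplxJ : Continuous (cplxJ : PhaseSpace n → PhaseSpace n) :=
  LinearMap.continuous_of_finiteDimensional _

theorem continuous_area_map_smul (ν : ι → PhaseSpace n) (l : List ι) :
    Continuous fun β : ι → ℝ => area (l.map fun i => β i • ν i) := by
  induction l with
  | nil => simpa using continuous_const
  | cons i l ih =>
    simp only [List.map_cons, area_cons]
    have h1 := continuous_sum_map_smul ν l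
    have h2 : Continuous fun β : ι → ℝ => cplxJ (β i • ν i) := continuous_cplxJ.comp (by fun_prop)
    exact ih.add (continuous_const.mul (h1.inner h2))

/-- `M` bounds the area of all sequences of vectors with total in `Eᗮ`, relative to the square of
their length measured by the support function of `K`. -/
def IsAreaBound (K : Set (PhaseSpace n)) (E : Submodule ℝ (PhaseSpace n)) (M : ℝ) : Prop :=
  ∀ (L : List (PhaseSpace n × ℝ)) (s : ℝ), (∀ p ∈ L, ∀ x ∈ K, inner ℝ x p.1 ≤ p.2) →
    (L.map Prod.fst).sum ∈ Eᗮ → (L.map Prod.snd).sum ≤ s → 0 < s →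
    area (L.map Prod.fst) ≤ M * s ^ 2

theorem sum_map_range {M : Type*} [AddCommMonoid M] (v : ℕ → M) (L : ℕ) :
    ((List.range L).map v).sum = ∑ b ∈ Finset.range L, v b := by
  rw [← List.sum_toFinset _ List.nodup_range]
  congr 1
  ext
  simp

theorem IsAreaBound.range_le {E : Submodule ℝ (PhaseSpace n)} {M : ℝ} (hM : IsAreaBound K E M)
    {L : ℕ} {v : ℕ → PhaseSpace n} {c : ℕ → ℝ} {s : ℝ}
    (hv : ∀ b < L, ∀ x ∈ K, inner ℝ x (v b) ≤ c b) (hE : ∑ b ∈ Finset.range L, v b ∈ Eᗮ)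
    (hs : ∑ b ∈ Finset.range L, c b ≤ s) (hs0 : 0 < s) :
    area ((List.range L).map v) ≤ M * s ^ 2 := by
  have h1 : ((List.range L).map fun b => (v b, c b)).map Prod.fst = (List.range L).map v := by
    simp [List.map_map, Function.comp_def]
  have h2 : ((List.range L).map fun b => (v b, c b)).map Prod.snd = (List.range L).map c := by
    simp [List.map_map, Function.comp_def]
  have := hM ((List.range L).map fun b => (v b, c b)) s ?_ ?_ ?_ hs0
  · rwa [h1] at this
  · intro p hp
    obtain ⟨b, hb, rfl⟩ := List.mem_map.1 hp
    exact hv b (List.mem_range.1 hb)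
  · rwa [h1, sum_map_range]
  · rwa [h2, sum_map_range]

/-- The square with edges `u, Ju, -u, -Ju` has total 0, which lies in every `Eᗮ`, and area 1, while
its length is at most `4R`. -/
theorem IsAreaBound.pos (hn : 0 < n) (hK : Bornology.IsBounded K) {E : Submodule ℝ (PhaseSpace n)}
    {M : ℝ} (hM : IsAreaBound K E M) : 0 < M := by
  obtain ⟨R, hR0, hR⟩ := hK.exists_pos_norm_le
  set u : PhaseSpace n := EuclideanSpace.single (Sum.inl ⟨0, hn⟩) 1 with hu
  have hu1 : ‖u‖ = 1 := by simp [hu]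
  have hJu : ‖cplxJ u‖ = 1 := by
    have := inner_cplxJ_cplxJ u u
    rw [real_inner_self_eq_norm_sq, real_inner_self_eq_norm_sq, hu1] at this
    nlinarith [norm_nonneg (cplxJ u)]
  have key : ∀ w : PhaseSpace n, ‖w‖ = 1 → ∀ x ∈ K, inner ℝ x w ≤ R := by
    intro w hw x hx
    calc inner ℝ x w ≤ ‖x‖ * ‖w‖ := real_inner_le_norm _ _
      _ ≤ R := by rw [hw, mul_one]; exact hR x hx
  have := hM [(u, R), (cplxJ u, R), (-u, R), (-cplxJ u, R)] (4 * R) ?_ ?_ ?_ (by positivity)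
  · have hA : area ([(u, R), (cplxJ u, R), (-u, R), (-cplxJ u, R)].map Prod.fst) = 1 := by
      simp only [List.map_cons, List.map_nil, area_cons, area_nil, List.sum_cons, List.sum_nil,
        map_neg, inner_neg_right, inner_add_left, inner_neg_left, inner_zero_left,
        cplxJ_cplxJ, inner_cplxJ_self, real_inner_self_eq_norm_sq, hJu, hu1]
      norm_num [inner_cplxJ_self, real_inner_comm]
    rw [hA] at this
    by_contra! hle
    nlinarith [sq_nonneg (4 * R)]
  · simp only [List.mem_cons, List.not_mem_nil, or_false]
    rintro p (rfl | rfl | rfl | rfl)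
    · exact key _ hu1
    · exact key _ hJu
    · exact key _ (by rwa [norm_neg])
    · exact key _ (by rwa [norm_neg])
  · simp
  · simp only [List.map_cons, List.map_nil, List.sum_cons, List.sum_nil]
    linarith

variable [Fintype ι]

/-- The largest area is attained by a sequence of multiples of the normals in which every normal
occurs at most once. -/
theorem IsHalfspaceRep.exists_maximizer (hrep : IsHalfspaceRep K ν h)
    (h0 : (0 : PhaseSpace n) ∈ interior K) (E : Submodule ℝ (PhaseSpace n)) :
    ∃ (l : List ι) (β : ι → ℝ), l.Nodup ∧ (∀ i, 0 ≤ β i) ∧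
      (l.map fun i => β i • ν i).sum ∈ Eᗮ ∧ (l.map fun i => β i * h i).sum ≤ 1 ∧
      IsAreaBound K E (area (l.map fun i => β i • ν i)) := by
  classical
  let A : List ι → Set (ι → ℝ) := fun l =>
    {β | (∀ i, 0 ≤ β i) ∧ ∑ i, β i * h i ≤ 1} ∩ {β | (l.map fun i => β i • ν i).sum ∈ Eᗮ}
  let S : Set ℝ := ⋃ l : {l : List ι // l.Nodup},
    (fun β : ι → ℝ => area (l.1.map fun i => β i • ν i)) '' A l.1
  -- There are only finitely many lists without repetition over a finite type.
  have hS : IsCompact S := by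
    refine isCompact_iUnion fun l => IsCompact.image ?_ (continuous_area_map_smul ν l.1)
    exact (isCompact_weights hrep.pos 1).inter_right
      (E.isClosed_orthogonal.preimage (continuous_sum_map_smul ν l.1))
  have hne : S.Nonempty := by
    refine ⟨_, mem_iUnion.2 ⟨⟨[], List.nodup_nil⟩, 0, ⟨⟨by simp, by simp⟩, by simp⟩, rfl⟩⟩
  obtain ⟨M, hMS, hM⟩ := hS.exists_isGreatest hne
  obtain ⟨⟨l, hl⟩, β, ⟨⟨hβ, hβ1⟩, hβE⟩, rfl⟩ := mem_iUnion.1 hMS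
  have hlsum : ∀ (f : ι → ℝ) (l : List ι), l.Nodup → (l.map f).sum = ∑ i ∈ l.toFinset, f i :=
    fun f l hl => (List.sum_toFinset f hl).symm
  refine ⟨l, β, hl, hβ, hβE, ?_, ?_⟩
  · rw [hlsum _ l hl]
    exact (Finset.sum_le_sum_of_subset_of_nonneg (Finset.subset_univ _)
      fun i _ _ => mul_nonneg (hβ i) (hrep.pos i).le).trans hβ1
  · intro L s hL hLE hLs hs
    obtain ⟨B, hB, hBs, hBc, hBA⟩ := hrep.exists_refinement h0 L hL
    obtain ⟨l', β', hl', hβ', hs', hc', hA'⟩ := exists_nodup_area_ge ν h B hB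
    -- The factor `s⁻¹` normalizes the length to at most 1 and divides the area by `s²`. Weights off
    -- `l'` are set to 0 because the constraint sums over all indices.
    let β'' : ι → ℝ := fun i => if i ∈ l' then s⁻¹ * β' i else 0
    have hmap : (l'.map fun i => β'' i • ν i) = (l'.map fun i => β' i • ν i).map (s⁻¹ • ·) := by
      rw [List.map_map]
      refine List.map_congr_left fun i hi => ?_
      simp [β'', hi, mul_smul]
    have hmem : β'' ∈ A l' := by
      refine ⟨⟨fun i => ?_, ?_⟩, ?_⟩
      · simp only [β'']
        split_ifs
        · exact mul_nonneg (inv_nonneg.2 hs.le) (hβ' i)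
        · exact le_rfl
      · have : ∑ i, β'' i * h i = s⁻¹ * ∑ i ∈ l'.toFinset, β' i * h i := by
          rw [Finset.mul_sum, ← Finset.sum_subset (Finset.subset_univ l'.toFinset)]
          · refine Finset.sum_congr rfl fun i hi => ?_
            rw [List.mem_toFinset] at hi
            simp only [β'', if_pos hi]
            ring
          · intro i _ hi
            rw [List.mem_toFinset] at hi
            simp [β'', hi]
        rw [this, ← hlsum _ _ hl', hc', inv_mul_le_iff₀ hs, mul_one]
        exact hBc.trans hLs
      · change (l'.map fun i => β'' i • ν i).sum ∈ Eᗮ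
        rw [hmap, ← List.smul_sum, hs', hBs]
        exact Submodule.smul_mem _ _ hLE
    have := hM (mem_iUnion.2 ⟨⟨l', hl'⟩, β'', hmem, rfl⟩)
    simp only at this
    rw [hmap, area_smul, inv_pow, inv_mul_le_iff₀ (by positivity)] at this
    linarith

end Maximum

/-! ### First variation and the Lagrange multiplier. -/

section FirstOrder

/-- Summation by parts, with the antisymmetry of `⟨·, J·⟩`. -/
theorem sum_inner_cplxJ_partial_sum (v e : ℕ → PhaseSpace n) (L : ℕ) :
    ∑ b ∈ Finset.range L, inner ℝ (v b) (cplxJ (∑ a ∈ Finset.range b, e a)) =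
      ∑ b ∈ Finset.range L, inner ℝ (e b)
        (cplxJ (∑ a ∈ Finset.range (b + 1), v a) - cplxJ (∑ a ∈ Finset.range L, v a)) := by
  induction L with
  | zero => simp
  | succ L ih =>
    rw [Finset.sum_range_succ, ih, Finset.sum_range_succ (n := L), sub_self, inner_zero_right,
      add_zero, Finset.sum_range_succ (f := v) (n := L)]
    simp only [map_add, inner_sub_right, inner_add_right, Finset.sum_sub_distrib,
      Finset.sum_add_distrib]
    rw [inner_cplxJ_swap (v L), sum_inner]
    ring

/-- The area is a quadratic form, so the expansion is exact. Its gradient in `v b` is the midpoint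
of the `b`-th edge of the polygon with edges `J v`, minus half the total displacement. -/
theorem area_map_range_add_smul (v e : ℕ → PhaseSpace n) (s : ℝ) (L : ℕ) :
    area ((List.range L).map fun b => v b + s • e b) = area ((List.range L).map v) +
      s * ∑ b ∈ Finset.range L, inner ℝ (e b) (cplxJ (∑ a ∈ Finset.range b, v a) +
        (1 / 2 : ℝ) • cplxJ (v b) - (1 / 2 : ℝ) • cplxJ (∑ a ∈ Finset.range L, v a)) +
      s ^ 2 * area ((List.range L).map e) := by
  have key := sum_inner_cplxJ_partial_sum v e L
  simp only [Finset.sum_range_succ, map_add, inner_sub_right, inner_add_right,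
    Finset.sum_sub_distrib, Finset.sum_add_distrib] at key
  simp only [area_map_range, Finset.sum_add_distrib, ← Finset.smul_sum, map_add, map_smul,
    inner_sub_right, inner_add_right, inner_add_left, inner_smul_left, inner_smul_right,
    Finset.sum_sub_distrib, ← Finset.mul_sum, conj_trivial]
  rw [key]
  ring

/-- A form of Farkas' lemma: solvability of slightly relaxed linear inequalities in a subspace. -/
theorem exists_mem_inner_lt {κ : Type*} [Fintype κ] (E : Submodule ℝ (PhaseSpace n))
    (u : κ → PhaseSpace n) (c d : κ → ℝ) (hd : ∀ k, 0 < d k)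
    (H : ∀ ε : κ → ℝ, (∀ k, 0 ≤ ε k) → ∑ k, ε k • u k ∈ Eᗮ → 0 ≤ ∑ k, ε k * c k) :
    ∃ a ∈ E, ∀ k, inner ℝ a (u k) < c k + d k := by
  classical
  by_contra! hcon
  -- If no `a` works, this open orthant is disjoint from the image of `E`. The coefficients of a
  -- separating functional are weights that contradict `H`.
  let U : Set (κ → ℝ) := univ.pi fun k => Iio (c k + d k)
  let φ : PhaseSpace n →ₗ[ℝ] (κ → ℝ) := LinearMap.pi fun k => (innerSL ℝ (u k)).toLinearMap
  have hφ : ∀ a k, φ a k = inner ℝ a (u k) := fun a k => real_inner_comm a (u k)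
  have hUo : IsOpen U := isOpen_set_pi finite_univ fun k _ => isOpen_Iio
  have hUc : Convex ℝ U := convex_pi fun k _ => convex_Iio _
  have hdisj : Disjoint U (E.map φ : Set (κ → ℝ)) := by
    rw [Set.disjoint_left]
    rintro _ hx ⟨a, ha, rfl⟩
    obtain ⟨k, hk⟩ := hcon a ha
    have := hx k (mem_univ k)
    rw [hφ, mem_Iio] at this
    linarith
  obtain ⟨f, r, hf1, hf2⟩ := geometric_hahn_banach_open hUc hUo (E.map φ).convex hdisj
  have hr : r ≤ 0 := by simpa using hf2 0 (E.map φ).zero_mem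
  -- A functional bounded below on a subspace vanishes on it.
  have hf0 : ∀ y ∈ E.map φ, f y = 0 := by
    intro y hy
    by_contra hne
    have := hf2 (((r - 1) / f y) • y) ((E.map φ).smul_mem _ hy)
    rw [map_smul, smul_eq_mul, div_mul_cancel₀ _ hne] at this
    linarith
  have hfx : ∀ x : κ → ℝ, f x = ∑ k, f (Pi.single k 1) * x k := by
    intro x
    conv_lhs => rw [← Finset.univ_sum_single x]
    rw [map_sum]
    refine Finset.sum_congr rfl fun k _ => ?_
    have : Pi.single k (x k) = x k • (Pi.single k 1 : κ → ℝ) := by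
      rw [← Pi.single_smul, smul_eq_mul, mul_one]
    rw [this, map_smul, smul_eq_mul, mul_comm]
  have hcU : ∀ k, ∀ t : ℝ, 0 ≤ t → c - t • (Pi.single k 1 : κ → ℝ) ∈ U := by
    intro k t ht j _
    have h1 : 0 ≤ (Pi.single k 1 : κ → ℝ) j := by
      by_cases hj : j = k
      · subst hj; simp
      · simp [hj]
    have := hd j
    simp only [Pi.sub_apply, Pi.smul_apply, smul_eq_mul, mem_Iio]
    nlinarith [mul_nonneg ht h1]
  -- `U` is unbounded in every negative coordinate direction while `f` stays below `r` on it.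
  have hpos : ∀ k, 0 ≤ f (Pi.single k 1) := by
    intro k
    by_contra! hneg
    have h1 := hf1 _ (hcU k (|r - f c| / -f (Pi.single k 1))
      (div_nonneg (abs_nonneg _) (by linarith)))
    rw [map_sub, map_smul, smul_eq_mul, div_mul_eq_mul_div, div_neg,
      mul_div_cancel_right₀ _ hneg.ne] at h1
    linarith [neg_abs_le (r - f c), le_abs_self (r - f c)]
  have hfc : f c < r := by
    by_cases hκ : Nonempty κ
    · obtain ⟨k⟩ := hκ
      simpa using hf1 _ (hcU k 0 le_rfl)
    · exact hf1 c fun k _ => absurd ⟨k⟩ hκ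
  have := H (fun k => f (Pi.single k 1)) hpos ?_
  · rw [← hfx] at this
    linarith
  · rw [Submodule.mem_orthogonal]
    intro a ha
    have := hf0 (φ a) ⟨a, ha, rfl⟩
    rw [hfx] at this
    rw [inner_sum, ← this]
    refine Finset.sum_congr rfl fun k _ => ?_
    rw [inner_smul_right, hφ]

variable {ι : Type*} {K : Set (PhaseSpace n)} {ν : ι → PhaseSpace n} {h : ι → ℝ}

theorem IsHalfspaceRep.isCompact_dilation (hrep : IsHalfspaceRep K ν h) {t : ℝ} (ht : 0 < t) :
    IsCompact {x : PhaseSpace n | ∀ i, inner ℝ x (ν i) ≤ t * h i} := by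
  refine Metric.isCompact_of_isClosed_isBounded ?_ ?_
  · simp only [ofPred_forall]
    exact isClosed_iInter fun i => isClosed_le (by fun_prop) continuous_const
  · obtain ⟨R, hR0, hR⟩ := hrep.bounded.exists_pos_norm_le
    refine (Metric.isBounded_closedBall (x := (0 : PhaseSpace n)) (r := t * R)).subset ?_
    intro x hx
    have hxK : t⁻¹ • x ∈ K := by
      rw [hrep.mem_iff]
      intro i
      rw [inner_smul_left]
      simp only [conj_trivial]
      rw [inv_mul_le_iff₀ ht]
      exact hx i
    have := hR _ hxK
    rw [norm_smul, norm_inv, Real.norm_of_nonneg ht.le, inv_mul_le_iff₀ ht] at this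
    simpa using this

variable [Fintype ι] {E : Submodule ℝ (PhaseSpace n)} {M : ℝ}

/-- Adding `s • e` with `s > 0` raises the length to at most `1 + sH`, so the area is at most `M(1 +
sH)²`. Subtracting `M`, dividing by `s` and letting `s → 0` gives the claim. -/
theorem first_variation_le (hrep : IsHalfspaceRep K ν h) (hM : IsAreaBound K E M)
    {L : ℕ} {v : ℕ → PhaseSpace n} {c : ℕ → ℝ}
    (hv : ∀ b < L, ∀ x ∈ K, inner ℝ x (v b) ≤ c b) (hE : ∑ b ∈ Finset.range L, v b ∈ Eᗮ)
    (hc : ∑ b ∈ Finset.range L, c b ≤ 1) (hA : area ((List.range L).map v) = M)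
    {ε : ℕ → ι → ℝ} (hε : ∀ b i, 0 ≤ ε b i)
    (hεE : ∑ b ∈ Finset.range L, ∑ i, ε b i • ν i ∈ Eᗮ) :
    ∑ b ∈ Finset.range L, inner ℝ (∑ i, ε b i • ν i) (cplxJ (∑ a ∈ Finset.range b, v a) +
        (1 / 2 : ℝ) • cplxJ (v b) - (1 / 2 : ℝ) • cplxJ (∑ a ∈ Finset.range L, v a)) ≤
      2 * M * ∑ b ∈ Finset.range L, ∑ i, ε b i * h i := by
  set e : ℕ → PhaseSpace n := fun b => ∑ i, ε b i • ν i with he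
  set D := ∑ b ∈ Finset.range L, inner ℝ (∑ i, ε b i • ν i) (cplxJ (∑ a ∈ Finset.range b, v a) +
        (1 / 2 : ℝ) • cplxJ (v b) - (1 / 2 : ℝ) • cplxJ (∑ a ∈ Finset.range L, v a)) with hD
  set H := ∑ b ∈ Finset.range L, ∑ i, ε b i * h i with hH
  have hH0 : 0 ≤ H := Finset.sum_nonneg fun b _ => Finset.sum_nonneg fun i _ =>
    mul_nonneg (hε b i) (hrep.pos i).le
  have key : ∀ s : ℝ, 0 < s → D ≤ 2 * M * H + s * (M * H ^ 2 - area ((List.range L).map e)) := by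
    intro s hs
    have := hM.range_le (L := L) (v := fun b => v b + s • e b)
      (c := fun b => c b + s * ∑ i, ε b i * h i) (s := 1 + s * H) ?_ ?_ ?_ (by positivity)
    · rw [area_map_range_add_smul, hA, ← hD] at this
      have h2 : s * D ≤ s * (2 * M * H + s * (M * H ^ 2 - area ((List.range L).map e))) := by
        linarith
      exact le_of_mul_le_mul_left h2 hs
    · intro b hb x hx
      rw [inner_add_right, inner_smul_right, he]
      simp only [inner_sum, inner_smul_right]
      gcongr with i _
      · exact hv b hb x hx
      · exact hε b i
      · exact (hrep.mem_iff x).1 hx i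
    · rw [Finset.sum_add_distrib, ← Finset.smul_sum]
      exact Submodule.add_mem _ hE (Submodule.smul_mem _ _ hεE)
    · rw [Finset.sum_add_distrib, ← Finset.mul_sum]
      linarith
  refine ge_of_tendsto (x := nhdsWithin (0 : ℝ) (Ioi 0)) (f := fun s =>
    2 * M * H + s * (M * H ^ 2 - area ((List.range L).map e))) ?_ ?_
  · refine tendsto_nhdsWithin_of_tendsto_nhds ?_
    have : Continuous fun s : ℝ => 2 * M * H + s * (M * H ^ 2 - area ((List.range L).map e)) := by
      fun_prop
    simpa using this.tendsto 0
  · filter_upwards [self_mem_nhdsWithin] with s hs using key s hs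

/-- The Lagrange multiplier of a sequence of maximal area. -/
theorem exists_multiplier_midpoint (hrep : IsHalfspaceRep K ν h) (hM : IsAreaBound K E M)
    (hM0 : 0 < M) {L : ℕ} (hL : 0 < L) {v : ℕ → PhaseSpace n} {c : ℕ → ℝ}
    (hv : ∀ b < L, ∀ x ∈ K, inner ℝ x (v b) ≤ c b) (hE : ∑ b ∈ Finset.range L, v b ∈ Eᗮ)
    (hc : ∑ b ∈ Finset.range L, c b ≤ 1) (hA : area ((List.range L).map v) = M) :
    ∃ a ∈ E, ∀ b < L, ∀ i, inner ℝ (cplxJ (∑ a ∈ Finset.range b, v a) +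
        (1 / 2 : ℝ) • cplxJ (v b) - (1 / 2 : ℝ) • cplxJ (∑ a ∈ Finset.range L, v a) + a) (ν i) ≤
      2 * M * h i := by
  set X : ℕ → PhaseSpace n := fun b => cplxJ (∑ a ∈ Finset.range b, v a) +
        (1 / 2 : ℝ) • cplxJ (v b) - (1 / 2 : ℝ) • cplxJ (∑ a ∈ Finset.range L, v a) with hX
  -- Separation solves only inequalities with slack `1 / (j + 1)`; compactness of a dilate of `K`
  -- then gives a limit without slack.
  have step : ∀ j : ℕ, ∃ a ∈ E, ∀ b < L, ∀ i,
      inner ℝ (X b + a) (ν i) ≤ (2 * M + 1 / ((j : ℝ) + 1)) * h i := by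
    intro j
    have hex := exists_mem_inner_lt E (κ := Fin L × ι) (fun k => ν k.2)
      (fun k => 2 * M * h k.2 - inner ℝ (X k.1) (ν k.2)) (fun k => 1 / ((j : ℝ) + 1) * h k.2)
      (fun k => mul_pos (by positivity) (hrep.pos _)) ?_
    · obtain ⟨a, ha, hlt⟩ := hex
      refine ⟨a, ha, fun b hb i => ?_⟩
      have := hlt (⟨b, hb⟩, i)
      rw [inner_add_left]
      simp only at this
      linarith
    · intro ε hε hεE
      -- Extension by 0 past `L`, where the values do not enter.
      set ε' : ℕ → ι → ℝ := fun b i => if hb : b < L then ε (⟨b, hb⟩, i) else 0 with hε'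
      have hε'0 : ∀ b i, 0 ≤ ε' b i := by
        intro b i
        simp only [hε']
        split_ifs
        · exact hε _
        · exact le_rfl
      have hεε : ∀ (b : Fin L) i, ε' b i = ε (b, i) := fun b i => by simp [hε']
      have hfv := first_variation_le hrep hM hv hE hc hA hε'0 ?_
      · have e1 : ∑ b ∈ Finset.range L, inner ℝ (∑ i, ε' b i • ν i) (X b) =
            ∑ k : Fin L × ι, ε k * inner ℝ (X k.1) (ν k.2) := by
          rw [Finset.sum_range, Fintype.sum_prod_type]
          refine Finset.sum_congr rfl fun b _ => ?_
          rw [sum_inner]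
          refine Finset.sum_congr rfl fun i _ => ?_
          rw [inner_smul_left, hεε, real_inner_comm]
          rfl
        have e2 : ∑ b ∈ Finset.range L, ∑ i, ε' b i * h i = ∑ k : Fin L × ι, ε k * h k.2 := by
          rw [Finset.sum_range, Fintype.sum_prod_type]
          simp only [hεε]
        have e3 : ∑ k : Fin L × ι, ε k * (2 * M * h k.2 - inner ℝ (X k.1) (ν k.2)) =
            2 * M * ∑ k : Fin L × ι, ε k * h k.2 -
              ∑ k : Fin L × ι, ε k * inner ℝ (X k.1) (ν k.2) := by
          rw [Finset.mul_sum, ← Finset.sum_sub_distrib]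
          exact Finset.sum_congr rfl fun k _ => by ring
        rw [e3, ← e1, ← e2]
        exact sub_nonneg.2 hfv
      · convert hεE using 1
        rw [Finset.sum_range, Fintype.sum_prod_type]
        simp only [hεε]
  choose a haE ha using step
  have hcpt := (hrep.isCompact_dilation (t := 2 * M + 1) (by positivity)).image
    (f := fun x => x - X 0) (by fun_prop)
  obtain ⟨a₀, -, φ, hφ, hlim⟩ := hcpt.tendsto_subseq (x := a) fun j => by
    refine ⟨X 0 + a j, fun i => (ha j 0 hL i).trans ?_, by simp⟩
    have := hrep.pos i
    gcongr
    rw [div_le_one (by positivity)]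
    linarith [(Nat.cast_nonneg j : (0 : ℝ) ≤ j)]
  refine ⟨a₀, ?_, fun b hb i => ?_⟩
  · exact (Submodule.closed_of_finiteDimensional E).mem_of_tendsto hlim
      (Filter.Eventually.of_forall fun j => haE _)
  · have h1 : Filter.Tendsto (fun j => inner ℝ (X b + a (φ j)) (ν i)) Filter.atTop
        (nhds (inner ℝ (X b + a₀) (ν i))) :=
      (tendsto_const_nhds.add hlim).inner tendsto_const_nhds
    have h2 : Filter.Tendsto (fun j : ℕ => (2 * M + 1 / ((φ j : ℝ) + 1)) * h i) Filter.atTop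
        (nhds ((2 * M + 0) * h i)) :=
      ((tendsto_const_nhds.add ((tendsto_one_div_add_atTop_nhds_zero_nat (𝕜 := ℝ)).comp
        hφ.tendsto_atTop))).mul tendsto_const_nhds
    rw [add_zero] at h2
    exact le_of_tendsto_of_tendsto' h1 h2 fun j => ha (φ j) b hb i

/-- The interleaved sequence has zeros at even places and `v a` at place `2a + 1`. -/
theorem sum_range_interleave {V : Type*} [AddCommMonoid V] (v : ℕ → V) (b : ℕ) :
    ∑ a ∈ Finset.range (2 * b), (if Even a then 0 else v (a / 2)) = ∑ a ∈ Finset.range b, v a := by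
  induction b with
  | zero => simp
  | succ b ih =>
    have h1 : (2 * b + 1) / 2 = b := by omega
    rw [show 2 * (b + 1) = 2 * b + 1 + 1 by ring, Finset.sum_range_succ, Finset.sum_range_succ, ih,
      Finset.sum_range_succ]
    simp [h1]

theorem area_map_range_interleave (v : ℕ → PhaseSpace n) (b : ℕ) :
    area ((List.range (2 * b)).map fun a => if Even a then 0 else v (a / 2)) =
      area ((List.range b).map v) := by
  induction b with
  | zero => simp
  | succ b ih =>
    have h1 : (2 * b + 1) / 2 = b := by omega
    rw [show 2 * (b + 1) = 2 * b + 1 + 1 by ring, area_map_range_succ, area_map_range_succ, ih,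
      area_map_range_succ, Finset.sum_range_succ, sum_range_interleave]
    simp [h1]

/-- The multiplier inequality holds at edge midpoints, and a zero edge has its midpoint at a vertex.
Inserting a zero edge before every edge and after the last one, `2m + 1` in all, gives the
inequality at every vertex. -/
theorem exists_multiplier (hrep : IsHalfspaceRep K ν h) (hM : IsAreaBound K E M)
    (hM0 : 0 < M) {m : ℕ} {v : ℕ → PhaseSpace n} {c : ℕ → ℝ}
    (hv : ∀ b < m, ∀ x ∈ K, inner ℝ x (v b) ≤ c b) (hE : ∑ b ∈ Finset.range m, v b ∈ Eᗮ)
    (hc : ∑ b ∈ Finset.range m, c b ≤ 1) (hA : area ((List.range m).map v) = M) :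
    ∃ a ∈ E, ∀ b ≤ m, ∀ i, inner ℝ (cplxJ (∑ a ∈ Finset.range b, v a) -
      (1 / 2 : ℝ) • cplxJ (∑ a ∈ Finset.range m, v a) + a) (ν i) ≤ 2 * M * h i := by
  have hs : ∀ {V : Type} [AddCommMonoid V] (v : ℕ → V),
      ∑ a ∈ Finset.range (2 * m + 1), (if Even a then 0 else v (a / 2)) =
        ∑ a ∈ Finset.range m, v a := by
    intro V _ v
    rw [Finset.sum_range_succ, sum_range_interleave]
    simp
  have hex := exists_multiplier_midpoint hrep hM hM0 (L := 2 * m + 1) (by omega)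
    (v := fun b => if Even b then 0 else v (b / 2)) (c := fun b => if Even b then 0 else c (b / 2))
    ?_ (by rwa [hs]) (by rwa [hs]) ?_
  · obtain ⟨a, ha, hle⟩ := hex
    refine ⟨a, ha, fun b hb i => ?_⟩
    have := hle (2 * b) (by omega) i
    rw [sum_range_interleave, hs] at this
    simpa using this
  · intro b hb x hx
    by_cases hev : Even b
    · simp [hev]
    · simp only [hev, if_false]
      exact hv _ (by rw [Nat.not_even_iff_odd] at hev; obtain ⟨r, rfl⟩ := hev; omega) x hx
  · rw [area_map_range_succ, area_map_range_interleave, hA]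
    simp

end FirstOrder

/-! ### Lower bound for the action of an arbitrary chord. -/

section LowerBound

theorem absolutelyContinuousOnInterval_inner {z : ℝ → PhaseSpace n} {a b : ℝ}
    (hz : AbsolutelyContinuousOnInterval z a b) (w : PhaseSpace n) :
    AbsolutelyContinuousOnInterval (fun t => inner ℝ (z t) w) a b := by
  unfold AbsolutelyContinuousOnInterval at hz ⊢
  refine squeeze_zero (fun _ => Finset.sum_nonneg fun _ _ => dist_nonneg) (fun E => ?_)
    (by simpa using hz.const_mul ‖w‖)
  rw [Finset.mul_sum]
  refine Finset.sum_le_sum fun i _ => ?_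
  rw [Real.dist_eq, ← inner_sub_left, dist_eq_norm, mul_comm]
  exact abs_real_inner_le_norm _ _

theorem inner_neg_cplxJ_left (x y : PhaseSpace n) :
    inner ℝ (-cplxJ x) y = inner ℝ x (cplxJ y) := by
  rw [inner_neg_left, inner_cplxJ_right]

namespace IsGLC

variable {K : Set (PhaseSpace n)} {k : ℕ} {T : ℝ} {z : ℝ → PhaseSpace n}

/-- As `J² = -1`, the normal is recovered as `-Jż`, which makes a measurable choice of normals
unnecessary. -/
theorem ae_velocity (hz : IsGLC K k T z) {a b : ℝ} (ha : 0 ≤ a) (hb : b ≤ T) :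
    ∀ᵐ t ∂(volume.restrict (Icc a b)), HasDerivAt z (deriv z t) t ∧
      -cplxJ (deriv z t) ∈ normalCone K (z t) := by
  have := ae_restrict_of_ae_restrict_of_subset (Icc_subset_Icc ha hb) hz.velocity
  filter_upwards [this] with t ht
  obtain ⟨y, hy, hd⟩ := ht
  rw [hd.deriv, cplxJ_cplxJ, neg_neg]
  exact ⟨hd, hy⟩

theorem absCont_sub (hz : IsGLC K k T z) {a b : ℝ} (ha : 0 ≤ a) (hab : a ≤ b) (hb : b ≤ T) :
    AbsolutelyContinuousOnInterval z a b := by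
  refine hz.absCont.mono ?_
  rw [uIcc_of_le hab, uIcc_of_le hz.pos.le]
  exact Icc_subset_Icc ha hb

theorem ae_deriv_inner (hz : IsGLC K k T z) {a b : ℝ} (ha : 0 ≤ a) (hab : a ≤ b) (hb : b ≤ T)
    (w : PhaseSpace n) :
    ∀ᵐ t ∂(volume.restrict (uIoc a b)),
      deriv (fun t => inner ℝ (z t) w) t = inner ℝ (deriv z t) w := by
  rw [uIoc_of_le hab]
  filter_upwards [ae_restrict_of_ae_restrict_of_subset Ioc_subset_Icc_self
    (hz.ae_velocity ha hb)] with t ht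
  have := ht.1.inner ℝ (hasDerivAt_const t w)
  simpa using this.deriv

theorem intervalIntegrable_inner (hz : IsGLC K k T z) {a b : ℝ} (ha : 0 ≤ a) (hab : a ≤ b)
    (hb : b ≤ T) (w : PhaseSpace n) :
    IntervalIntegrable (fun t => inner ℝ (deriv z t) w) volume a b :=
  (absolutelyContinuousOnInterval_inner (hz.absCont_sub ha hab hb) w).intervalIntegrable_deriv.congr_ae
    (hz.ae_deriv_inner ha hab hb w)

theorem integral_inner (hz : IsGLC K k T z) {a b : ℝ} (ha : 0 ≤ a) (hab : a ≤ b)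
    (hb : b ≤ T) (w : PhaseSpace n) :
    ∫ t in a..b, inner ℝ (deriv z t) w = inner ℝ (z b - z a) w := by
  rw [inner_sub_left, ← (absolutelyContinuousOnInterval_inner (hz.absCont_sub ha hab hb)
    w).integral_deriv_eq_sub]
  exact (intervalIntegral.integral_congr_ae_restrict (hz.ae_deriv_inner ha hab hb w)).symm

/-- In coordinates the integrand is a sum of products of an integrable and a continuous function. -/
theorem intervalIntegrable_action (hz : IsGLC K k T z) {a b : ℝ} (ha : 0 ≤ a) (hab : a ≤ b)
    (hb : b ≤ T) :
    IntervalIntegrable (fun t => inner ℝ (-cplxJ (deriv z t)) (z t)) volume a b := by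
  have hc : ContinuousOn z (uIcc a b) := (hz.absCont_sub ha hab hb).continuousOn
  have hexp : (fun t => inner ℝ (-cplxJ (deriv z t)) (z t)) =
      ∑ i, fun t => inner ℝ (deriv z t) (EuclideanSpace.single i 1) * cplxJ (z t) i := by
    funext t
    rw [Finset.sum_apply, inner_neg_cplxJ_left, PiLp.inner_apply]
    refine Finset.sum_congr rfl fun i _ => ?_
    simp [EuclideanSpace.inner_single_right, mul_comm]
  rw [hexp]
  refine IntervalIntegrable.sum _ fun i _ => ?_
  refine (hz.intervalIntegrable_inner ha hab hb _).mul_continuousOn ?_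
  exact ((EuclideanSpace.proj (𝕜 := ℝ) i).continuous.comp continuous_cplxJ).comp_continuousOn hc

/-- The normal cone inequality `⟨x, -Jż⟩ ≤ ⟨z, -Jż⟩`, integrated: the gauge of a chord's increment
is at most the length of that piece. -/
theorem inner_sub_le (hz : IsGLC K k T z) {a b : ℝ} (ha : 0 ≤ a) (hab : a ≤ b) (hb : b ≤ T)
    {x : PhaseSpace n} (hx : x ∈ K) :
    inner ℝ x (-cplxJ (z b - z a)) ≤ ∫ t in a..b, inner ℝ (-cplxJ (deriv z t)) (z t) := by
  rw [real_inner_comm, inner_neg_cplxJ_left, ← hz.integral_inner ha hab hb]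
  refine intervalIntegral.integral_mono_ae_restrict hab
    (hz.intervalIntegrable_inner ha hab hb _) (hz.intervalIntegrable_action ha hab hb) ?_
  filter_upwards [hz.ae_velocity ha hb] with t ht
  have := ht.2 x hx
  rw [inner_sub_left] at this
  rw [← inner_neg_cplxJ_left, real_inner_comm, real_inner_comm (z t)]
  linarith

/-- A ball of radius `r` in `K` gives `r‖y‖ ≤ ⟨y, z t⟩` for normals `y` at `z t`. Replacing `z t` by
`z a` costs at most `ηr‖y‖`, a fraction `η` of the integrand. -/
theorem le_inner_sub (hz : IsGLC K k T z) {r η : ℝ} (hr : 0 < r)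
    (hball : Metric.closedBall 0 r ⊆ K) {a b : ℝ} (ha : 0 ≤ a) (hab : a ≤ b) (hb : b ≤ T)
    (hosc : ∀ t ∈ Icc a b, ‖z t - z a‖ ≤ η * r) :
    (1 - η) * ∫ t in a..b, inner ℝ (-cplxJ (deriv z t)) (z t) ≤
      inner ℝ (-cplxJ (z b - z a)) (z a) := by
  rw [inner_neg_cplxJ_left, ← hz.integral_inner ha hab hb, ← intervalIntegral.integral_const_mul]
  refine intervalIntegral.integral_mono_ae_restrict hab
    ((hz.intervalIntegrable_action ha hab hb).const_mul _)
    (hz.intervalIntegrable_inner ha hab hb _) ?_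
  filter_upwards [hz.ae_velocity ha hb, ae_restrict_mem measurableSet_Icc] with t ht htab
  rw [← inner_neg_cplxJ_left]
  set y := -cplxJ (deriv z t)
  have h1 : r * ‖y‖ ≤ inner ℝ y (z t) := by
    rcases eq_or_ne y 0 with h | h
    · simp [h]
    have hy := norm_pos_iff.2 h
    have := ht.2 ((r / ‖y‖) • y) (hball (by
      rw [mem_closedBall_zero_iff, norm_smul, Real.norm_of_nonneg (by positivity),
        div_mul_cancel₀ _ hy.ne']))
    rw [inner_sub_left, inner_smul_left, real_inner_self_eq_norm_sq, real_inner_comm] at this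
    simp only [conj_trivial] at this
    rw [pow_two, ← mul_assoc, div_mul_cancel₀ _ hy.ne'] at this
    linarith
  have h2 : inner ℝ y (z t) - inner ℝ y (z a) ≤ ‖y‖ * (η * r) := by
    rw [← inner_sub_right]
    exact (real_inner_le_norm _ _).trans (by gcongr; exact hosc t htab)
  have hη : 0 ≤ η := by
    have := (norm_nonneg _).trans (hosc a (left_mem_Icc.2 hab))
    exact nonneg_of_mul_nonneg_left this hr
  nlinarith

theorem integral_pos (hz : IsGLC K k T z) (h0 : (0 : PhaseSpace n) ∈ interior K) :
    0 < ∫ t in (0 : ℝ)..T, inner ℝ (-cplxJ (deriv z t)) (z t) := by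
  have key : ∀ s t, 0 ≤ s → s ≤ t → t ≤ T → z s ≠ z t →
      0 < ∫ t in (0 : ℝ)..T, inner ℝ (-cplxJ (deriv z t)) (z t) := by
    intro s t hs hst ht hne
    have hnn : ∀ a b, 0 ≤ a → a ≤ b → b ≤ T →
        0 ≤ ∫ t in a..b, inner ℝ (-cplxJ (deriv z t)) (z t) := by
      intro a b ha hab hb
      simpa using hz.inner_sub_le ha hab hb (interior_subset h0)
    have hne' : -cplxJ (z t - z s) ≠ 0 := by
      intro h
      have : cplxJ (cplxJ (z t - z s)) = 0 := by rw [neg_eq_zero.1 h, map_zero]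
      rw [cplxJ_cplxJ, neg_eq_zero, sub_eq_zero] at this
      exact hne this.symm
    obtain ⟨x, hx, hpos⟩ := exists_mem_inner_pos h0 hne'
    have h1 := hpos.trans_le (hz.inner_sub_le hs hst ht hx)
    have h2 := hnn 0 s le_rfl hs (hst.trans ht)
    have h3 := hnn t T (hs.trans hst) ht le_rfl
    have hI : ∀ a b, 0 ≤ a → a ≤ b → b ≤ T → IntervalIntegrable
        (fun t => inner ℝ (-cplxJ (deriv z t)) (z t)) volume a b :=
      fun a b ha hab hb => hz.intervalIntegrable_action ha hab hb
    rw [← intervalIntegral.integral_add_adjacent_intervals (hI 0 s le_rfl hs (hst.trans ht))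
      (hI s T hs (hst.trans ht) le_rfl), ← intervalIntegral.integral_add_adjacent_intervals
      (hI s t hs hst ht) (hI t T (hs.trans hst) ht le_rfl)]
    linarith
  obtain ⟨s, hs, t, ht, hne⟩ := hz.nonconstant
  rcases le_total s t with h | h
  · exact key s t hs.1 h ht.2 hne
  · exact key t s ht.1 h hs.2 hne.symm

/-- The area bound is applied to the increments over a partition so fine that `z` oscillates by less
than `ηr` on each piece. -/
theorem one_sub_mul_le (hz : IsGLC K k T z) (h0 : (0 : PhaseSpace n) ∈ interior K) {M : ℝ}
    (hM : IsAreaBound K (coisoSubspace n k) M) {η : ℝ} (hη : 0 < η) :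
    1 - η ≤ 2 * M * ∫ t in (0 : ℝ)..T, inner ℝ (-cplxJ (deriv z t)) (z t) := by
  obtain ⟨r, hr, hball⟩ := Metric.nhds_basis_closedBall.mem_iff.1 (mem_interior_iff_mem_nhds.1 h0)
  have hT := hz.pos
  have huc : UniformContinuousOn z (Icc 0 T) := by
    have := hz.absCont.uniformContinuousOn
    rwa [uIcc_of_le hT.le] at this
  obtain ⟨δ, hδ, hosc⟩ := Metric.uniformContinuousOn_iff.1 huc (η * r) (by positivity)
  obtain ⟨L, hL⟩ := exists_nat_gt (T / δ)
  have hL0 : (0 : ℝ) < L := (div_pos hT hδ).trans hL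
  set τ : ℕ → ℝ := fun b => b * (T / L) with hτ
  have hstep : ∀ b, τ (b + 1) - τ b = T / L := fun b => by simp only [hτ]; push_cast; ring
  have hTL : 0 < T / L := by positivity
  have hτ0 : ∀ b, 0 ≤ τ b := fun b => by positivity
  have hτT : ∀ b ≤ L, τ b ≤ T := by
    intro b hb
    calc τ b ≤ L * (T / L) := by simp only [hτ]; gcongr
      _ = T := by field_simp
  have hτL : τ L = T := by simp only [hτ]; field_simp
  have hτz : τ 0 = 0 := by simp [hτ]
  set ℓ := ∫ t in (0 : ℝ)..T, inner ℝ (-cplxJ (deriv z t)) (z t) with hℓ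
  have hℓ0 : 0 < ℓ := hz.integral_pos h0
  set v : ℕ → PhaseSpace n := fun b => -cplxJ (z (τ (b + 1)) - z (τ b)) with hv
  set c : ℕ → ℝ := fun b => ∫ t in τ b..τ (b + 1), inner ℝ (-cplxJ (deriv z t)) (z t) with hc
  have hsumv : ∀ b, ∑ a ∈ Finset.range b, v a = -cplxJ (z (τ b) - z 0) := by
    intro b
    simp only [hv]
    rw [Finset.sum_neg_distrib, ← map_sum, Finset.sum_range_sub (fun b => z (τ b)), hτz]
  have hsumc : ∑ b ∈ Finset.range L, c b = ℓ := by
    have := intervalIntegral.sum_integral_adjacent_intervals (μ := volume) (a := τ) (n := L)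
      (f := fun t => inner ℝ (-cplxJ (deriv z t)) (z t)) fun b hb => ?_
    · rwa [hτz, hτL] at this
    exact hz.intervalIntegrable_action (hτ0 b) (by linarith [hstep b]) (hτT _ hb)
  have hE : ∑ b ∈ Finset.range L, v b ∈ (coisoSubspace n k)ᗮ := by
    rw [mem_coisoSubspace_orthogonal_iff, hsumv, map_neg, cplxJ_cplxJ, neg_neg, hτL, ← neg_sub]
    exact Submodule.neg_mem _ hz.leaf
  have hle := hM.range_le (L := L) (v := v) (c := c) (s := ℓ) ?_ hE hsumc.le hℓ0
  · have harea : (1 / 2) * ((1 - η) * ℓ) ≤ area ((List.range L).map v) := by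
      have e1 : area ((List.range L).map v) =
          (1 / 2) * ∑ b ∈ Finset.range L, inner ℝ (v b) (z (τ b)) := by
        -- The total is orthogonal to the coisotropic subspace, which contains `z 0`, so the choice
        -- of origin does not affect the area.
        have hz0 : ∑ b ∈ Finset.range L, inner ℝ (v b) (z 0) = 0 := by
          rw [← sum_inner]
          exact (Submodule.mem_orthogonal' _ _).1 hE _ hz.start_mem
        rw [area_map_range, ← Finset.mul_sum]
        congr 1
        rw [← sub_zero (∑ b ∈ Finset.range L, inner ℝ (v b) (z (τ b))), ← hz0,
          ← Finset.sum_sub_distrib]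
        refine Finset.sum_congr rfl fun b _ => ?_
        rw [hsumv, map_neg, cplxJ_cplxJ, neg_neg, inner_sub_right]
      rw [e1, ← hsumc, Finset.mul_sum]
      gcongr with b hb
      have hb' := Finset.mem_range.1 hb
      refine hz.le_inner_sub hr hball (hτ0 b) (by linarith [hstep b]) (hτT _ hb') fun t ht => ?_
      have hb1 := hτT _ hb'
      have := hosc t ⟨(hτ0 b).trans ht.1, ht.2.trans hb1⟩ (τ b) ⟨hτ0 b, hτT _ hb'.le⟩ ?_
      · rw [dist_eq_norm] at this
        exact this.le
      · rw [Real.dist_eq, abs_of_nonneg (by linarith [ht.1])]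
        calc t - τ b ≤ T / L := by linarith [ht.2, hstep b]
          _ < δ := by rwa [div_lt_comm₀ hL0 hδ]
    have : (1 - η) * ℓ ≤ (2 * M * ℓ) * ℓ := by nlinarith
    exact le_of_mul_le_mul_right this hℓ0
  · intro b hb x hx
    exact hz.inner_sub_le (hτ0 b) (by linarith [hstep b]) (hτT _ hb) hx

theorem le_action (hz : IsGLC K k T z) (h0 : (0 : PhaseSpace n) ∈ interior K) {M : ℝ}
    (hM : IsAreaBound K (coisoSubspace n k) M) (hM0 : 0 < M) : 1 / (4 * M) ≤ action T z := by
  have h1 : 1 ≤ 2 * M * ∫ t in (0 : ℝ)..T, inner ℝ (-cplxJ (deriv z t)) (z t) :=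
    le_of_forall_pos_le_add fun η hη => by linarith [hz.one_sub_mul_le h0 hM hη]
  rw [action, div_le_iff₀ (by positivity)]
  linarith

end IsGLC

end LowerBound

/-! ### Polygonal paths. -/

section PolygonalPath

variable {V : Type*} [NormedAddCommGroup V] [NormedSpace ℝ V]

/-- The polygonal path that starts at `P` and has velocity `w b` on `[τ b, τ (b + 1)]`, `b < m`. -/
def polygonalPath (P : V) (w : ℕ → V) (τ : ℕ → ℝ) (m : ℕ) (t : ℝ) : V :=
  P + ∑ b ∈ Finset.range m, (min t (τ (b + 1)) - min t (τ b)) • w b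

variable {P : V} {w : ℕ → V} {τ : ℕ → ℝ} {m : ℕ}

theorem polygonalPath_vertex (hτ : Monotone τ) :
    polygonalPath P w τ m (τ m) = P + ∑ a ∈ Finset.range m, (τ (a + 1) - τ a) • w a := by
  rw [polygonalPath]
  congr 1
  refine Finset.sum_congr rfl fun a ha => ?_
  have := Finset.mem_range.1 ha
  rw [min_eq_right (hτ this), min_eq_right (hτ this.le)]

/-- Edges before `b` are complete; for edges after `b` both minima equal `t` and cancel. -/
theorem polygonalPath_eq (hτ : Monotone τ) {b : ℕ} (hb : b < m) {t : ℝ}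
    (ht : t ∈ Icc (τ b) (τ (b + 1))) :
    polygonalPath P w τ m t =
      P + ∑ a ∈ Finset.range b, (τ (a + 1) - τ a) • w a + (t - τ b) • w b := by
  rw [polygonalPath, ← Finset.sum_subset (Finset.range_subset_range.2 (Nat.succ_le_of_lt hb)),
    Finset.sum_range_succ, ← add_assoc, min_eq_left ht.2, min_eq_right ht.1]
  · congr 2
    refine Finset.sum_congr rfl fun a ha => ?_
    have := Finset.mem_range.1 ha
    rw [min_eq_right ((hτ this).trans ht.1), min_eq_right ((hτ this.le).trans ht.1)]
  · intro a _ ha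
    have : b + 1 ≤ a := by simpa using ha
    rw [min_eq_left (ht.2.trans (hτ (this.trans a.le_succ))), min_eq_left (ht.2.trans (hτ this)),
      sub_self, zero_smul]

theorem hasDerivWithinAt_polygonalPath (hτ : Monotone τ) {b : ℕ} (hb : b < m) {t : ℝ}
    (ht : t ∈ Icc (τ b) (τ (b + 1))) :
    HasDerivWithinAt (polygonalPath P w τ m) (w b) (Icc (τ b) (τ (b + 1))) t := by
  have h1 : HasDerivAt (fun t : ℝ => P + ∑ a ∈ Finset.range b, (τ (a + 1) - τ a) • w a +
      (t - τ b) • w b) (w b) t := by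
    simpa using (((hasDerivAt_id t).sub_const (τ b)).smul_const (w b)).const_add
      (P + ∑ a ∈ Finset.range b, (τ (a + 1) - τ a) • w a)
  exact h1.hasDerivWithinAt.congr (fun s hs => polygonalPath_eq hτ hb hs)
    (polygonalPath_eq hτ hb ht)

theorem hasDerivAt_polygonalPath (hτ : Monotone τ) {b : ℕ} (hb : b < m) {t : ℝ}
    (ht : t ∈ Ioo (τ b) (τ (b + 1))) : HasDerivAt (polygonalPath P w τ m) (w b) t :=
  (hasDerivWithinAt_polygonalPath hτ hb (Ioo_subset_Icc_self ht)).hasDerivAt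
    (Icc_mem_nhds ht.1 ht.2)

theorem absolutelyContinuousOnInterval_polygonalPath (P : V) (w : ℕ → V) (τ : ℕ → ℝ) (m : ℕ)
    (a b : ℝ) : AbsolutelyContinuousOnInterval (polygonalPath P w τ m) a b := by
  have hconst : ∀ x : V, AbsolutelyContinuousOnInterval (fun _ => x) a b := fun x =>
    ((LipschitzWith.const x).lipschitzOnWith).absolutelyContinuousOnInterval
  have hmin : ∀ c : ℝ, AbsolutelyContinuousOnInterval (fun t => min t c) a b := fun c =>
    ((LipschitzWith.id.min_const c).lipschitzOnWith).absolutelyContinuousOnInterval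
  induction m with
  | zero =>
    have : polygonalPath P w τ 0 = fun _ => P := by funext t; simp [polygonalPath]
    rw [this]
    exact hconst P
  | succ m ih =>
    have : polygonalPath P w τ (m + 1) = polygonalPath P w τ m +
        ((fun t => min t (τ (m + 1))) - fun t => min t (τ m)) • fun _ => w m := by
      funext t
      simp [polygonalPath, Finset.sum_range_succ, add_assoc]
    rw [this]
    exact ih.add (((hmin _).sub (hmin _)).smul (hconst _))

theorem exists_mem_Ico_of_mem {t : ℝ} (h0 : τ 0 ≤ t) (hm : t < τ m) :
    ∃ b < m, t ∈ Ico (τ b) (τ (b + 1)) := by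
  induction m with
  | zero => exact absurd hm h0.not_gt
  | succ m ih =>
    by_cases h : t < τ m
    · obtain ⟨b, hb, htb⟩ := ih h
      exact ⟨b, hb.trans m.lt_succ_self, htb⟩
    · exact ⟨m, m.lt_succ_self, not_lt.1 h, hm⟩

theorem ae_exists_mem_Ioo (τ : ℕ → ℝ) (m : ℕ) :
    ∀ᵐ t ∂(volume.restrict (Icc (τ 0) (τ m))), ∃ b < m, t ∈ Ioo (τ b) (τ (b + 1)) := by
  have hnull : ∀ᵐ t : ℝ, t ∉ τ '' Iic m :=
    measure_eq_zero_iff_ae_notMem.1 (((finite_Iic m).image τ).measure_zero volume)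
  filter_upwards [ae_restrict_of_ae hnull, ae_restrict_mem measurableSet_Icc] with t ht htm
  have hne : ∀ b ≤ m, t ≠ τ b := fun b hb h => ht ⟨b, hb, h.symm⟩
  obtain ⟨b, hb, htb⟩ := exists_mem_Ico_of_mem htm.1 (lt_of_le_of_ne htm.2 (hne m le_rfl))
  exact ⟨b, hb, lt_of_le_of_ne htb.1 (hne b hb.le).symm, htb.2⟩

end PolygonalPath

/-! ### From a maximizer to a polygon inscribed in `K`. -/

section ExtremalPolygon

theorem sum_map_filter_eq {ι M : Type*} [AddCommMonoid M] (p : ι → Prop) [DecidablePred p]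
    (f : ι → M) (hf : ∀ i, ¬p i → f i = 0) (l : List ι) :
    ((l.filter p).map f).sum = (l.map f).sum := by
  induction l with
  | nil => simp
  | cons i l ih =>
    by_cases hi : p i
    · simp [hi, ih]
    · simp [hi, ih, hf i hi]

theorem area_map_filter_eq {ι : Type*} (p : ι → Prop) [DecidablePred p]
    (f : ι → PhaseSpace n) (hf : ∀ i, ¬p i → f i = 0) (l : List ι) :
    area ((l.filter p).map f) = area (l.map f) := by
  induction l with
  | nil => simp
  | cons i l ih =>
    have hs := sum_map_filter_eq p f hf l
    by_cases hi : p i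
    · simp only [List.filter_cons, hi, decide_true, if_true, List.map_cons, area_cons, ih, hs]
    · simp [hi, area_cons, ih, hf i hi]

variable {ι : Type*} {K : Set (PhaseSpace n)} {ν : ι → PhaseSpace n} {h : ι → ℝ}

theorem IsHalfspaceRep.exists_maximizer_range [Fintype ι] (hrep : IsHalfspaceRep K ν h)
    (hn : 0 < n)
    (h0 : (0 : PhaseSpace n) ∈ interior K) (E : Submodule ℝ (PhaseSpace n)) :
    ∃ (m : ℕ) (σ : ℕ → ι) (β : ℕ → ℝ), 0 < m ∧ InjOn σ (Iio m) ∧ (∀ b, 0 ≤ β b) ∧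
      (∀ b < m, 0 < β b) ∧ ∑ b ∈ Finset.range m, β b • ν (σ b) ∈ Eᗮ ∧
      ∑ b ∈ Finset.range m, β b * h (σ b) = 1 ∧
      IsAreaBound K E (area ((List.range m).map fun b => β b • ν (σ b))) := by
  obtain ⟨l, β, hl, hβ, hE, hc, hM⟩ := hrep.exists_maximizer h0 E
  have hM0 := hM.pos hn hrep.bounded
  have hz : ∀ i, ¬0 < β i → β i = 0 := fun i hi => le_antisymm (not_lt.1 hi) (hβ i)
  have e1 := sum_map_filter_eq (fun i => 0 < β i) (fun i => β i • ν i)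
    (fun i hi => by simp [hz i hi]) l
  have e2 := sum_map_filter_eq (fun i => 0 < β i) (fun i => β i * h i)
    (fun i hi => by simp [hz i hi]) l
  have e3 := area_map_filter_eq (fun i => 0 < β i) (fun i => β i • ν i)
    (fun i hi => by simp [hz i hi]) l
  rw [← e1] at hE
  rw [← e2] at hc
  rw [← e3] at hM hM0
  have hl' := hl.filter fun i => 0 < β i
  have hpos : ∀ i ∈ l.filter fun i => 0 < β i, 0 < β i := fun i hi => by
    simpa using (List.mem_filter.1 hi).2
  generalize (l.filter fun i => 0 < β i) = l' at *
  have hne : l' ≠ [] := by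
    rintro rfl
    simp at hM0
  set i₀ := l'.head hne
  -- The default `i₀` only fills in indices past the end of the list.
  set σ : ℕ → ι := fun b => l'.getD b i₀ with hσ
  have hσb : ∀ b (hb : b < l'.length), σ b = l'[b] := fun b hb => by
    simp [hσ, List.getD_eq_getElem?_getD, hb]
  have hmap : ∀ {M : Type} (f : ι → M), (List.range l'.length).map (fun b => f (σ b)) =
      l'.map f := by
    intro M f
    refine List.ext_getElem (by simp) fun b hb hb' => ?_
    simp only [List.length_map, List.length_range] at hb
    simp [hσb b hb]
  have hm : 0 < l'.length := List.length_pos_iff.2 hne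
  have hcost : ∑ b ∈ Finset.range l'.length, β (σ b) * h (σ b) ≤ 1 := by
    rwa [← sum_map_range, hmap fun i => β i * h i]
  have hsum : ∑ b ∈ Finset.range l'.length, β (σ b) • ν (σ b) ∈ Eᗮ := by
    rwa [← sum_map_range, hmap fun i => β i • ν i]
  have hpos' : ∀ b < l'.length, 0 < β (σ b) := fun b hb => by
    rw [hσb b hb]
    exact hpos _ (List.getElem_mem hb)
  rw [← hmap fun i => β i • ν i] at hM hM0
  refine ⟨l'.length, σ, fun b => β (σ b), hm, ?_, fun b => hβ _, hpos', hsum, ?_, hM⟩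
  · intro b hb b' hb' hbb
    rw [hσb b hb, hσb b' hb'] at hbb
    exact (hl'.getElem_inj_iff).1 hbb
  -- The length is exactly 1: a length `s < 1` would bound the area `M` by `M s² < M`.
  · refine le_antisymm hcost ?_
    set s := ∑ b ∈ Finset.range l'.length, β (σ b) * h (σ b) with hs
    have hs0 : 0 < s := Finset.sum_pos (fun b hb => mul_pos (hpos' b (Finset.mem_range.1 hb))
      (hrep.pos _)) ⟨0, Finset.mem_range.2 hm⟩
    have := hM.range_le (L := l'.length) (v := fun b => β (σ b) • ν (σ b))
      (c := fun b => β (σ b) * h (σ b)) (s := s) ?_ hsum le_rfl hs0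
    · by_contra! hlt
      have h1 : s ^ 2 < 1 := by nlinarith
      nlinarith
    · intro b _ x hx
      rw [inner_smul_right]
      exact mul_le_mul_of_nonneg_left ((hrep.mem_iff x).1 hx _) (hβ _)

/-- A polygon inscribed in `K`, closed modulo the leaf relation: its `b`-th edge is
`β b / (2 M) • J (ν (σ b))` and lies in the face with normal `ν (σ b)`, and no normal is used
twice. -/
structure IsExtremalPolygon (K : Set (PhaseSpace n)) (ν : ι → PhaseSpace n) (h : ι → ℝ) (k : ℕ)
    (M : ℝ) (m : ℕ) (σ : ℕ → ι) (β : ℕ → ℝ) (P : ℕ → PhaseSpace n) : Prop where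
  pos : 0 < M
  length_pos : 0 < m
  injOn : InjOn σ (Iio m)
  weight_nonneg : ∀ b, 0 ≤ β b
  weight_pos : ∀ b < m, 0 < β b
  sum_weight : ∑ b ∈ Finset.range m, β b * h (σ b) = 1
  mem : ∀ b ≤ m, P b ∈ K
  vertex_succ : ∀ b, P (b + 1) = P b + (β b / (2 * M)) • cplxJ (ν (σ b))
  inner_eq : ∀ b < m, inner ℝ (P b) (ν (σ b)) = h (σ b)
  start_mem : P 0 ∈ coisoSubspace n k
  end_mem : P m ∈ coisoSubspace n k
  leaf : P 0 - P m ∈ leafSubspace n k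

/-- A sequence of maximal area gives an extremal polygon. -/
theorem IsHalfspaceRep.exists_extremal_polygon [Fintype ι] (hrep : IsHalfspaceRep K ν h)
    (hn : 0 < n) (h0 : (0 : PhaseSpace n) ∈ interior K) (k : ℕ) :
    ∃ (M : ℝ) (m : ℕ) (σ : ℕ → ι) (β : ℕ → ℝ) (P : ℕ → PhaseSpace n),
      IsAreaBound K (coisoSubspace n k) M ∧ IsExtremalPolygon K ν h k M m σ β P := by
  obtain ⟨m, σ, β, hm, hσ, hβ, hβ0, hE, hc, hM⟩ :=
    hrep.exists_maximizer_range hn h0 (coisoSubspace n k)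
  have hM0 := hM.pos hn hrep.bounded
  set v : ℕ → PhaseSpace n := fun b => β b • ν (σ b) with hv
  set M := area ((List.range m).map v) with hMdef
  have hvK : ∀ b, ∀ x ∈ K, inner ℝ x (v b) ≤ β b * h (σ b) := fun b x hx => by
    rw [hv, inner_smul_right]
    exact mul_le_mul_of_nonneg_left ((hrep.mem_iff x).1 hx _) (hβ _)
  obtain ⟨a, ha, hmul⟩ := exists_multiplier hrep hM hM0 (fun b _ => hvK b) hE hc.le rfl
  set Y : ℕ → PhaseSpace n := fun b => ∑ a ∈ Finset.range b, v a with hY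
  set P : ℕ → PhaseSpace n := fun b =>
    (1 / (2 * M)) • (cplxJ (Y b) - (1 / 2 : ℝ) • cplxJ (Y m) + a) with hP
  have hleaf : cplxJ (Y m) ∈ leafSubspace n k := mem_coisoSubspace_orthogonal_iff.1 hE
  have hcoiso := leafSubspace_le n k hleaf
  have hPK : ∀ b ≤ m, P b ∈ K := by
    intro b hb
    rw [hrep.mem_iff]
    intro i
    simp only [hP, inner_smul_left, conj_trivial]
    rw [one_div, inv_mul_le_iff₀ (by positivity)]
    exact hmul b hb i
  -- The sum is `1 / (2M)` times twice the area `M`; the constant translation lies in `E`, so it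
  -- pairs to 0 with the total.
  have hsum : ∑ b ∈ Finset.range m, inner ℝ (P b) (v b) = 1 := by
    have e1 : ∀ b, inner ℝ (P b) (v b) = (1 / (2 * M)) * (2 * ((1 / 2) * inner ℝ (v b)
        (cplxJ (∑ a ∈ Finset.range b, v a))) + inner ℝ (a - (1 / 2 : ℝ) • cplxJ (Y m)) (v b)) := by
      intro b
      simp only [hP, inner_smul_left, conj_trivial, inner_add_left, inner_sub_left]
      rw [real_inner_comm (v b) (cplxJ (Y b))]
      ring
    have e2 : inner ℝ (a - (1 / 2 : ℝ) • cplxJ (Y m)) (Y m) = 0 :=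
      (Submodule.mem_orthogonal _ _).1 hE _
        (Submodule.sub_mem _ ha (Submodule.smul_mem _ _ hcoiso))
    simp only [e1]
    rw [← Finset.mul_sum, Finset.sum_add_distrib, ← Finset.mul_sum, ← area_map_range, ← inner_sum,
      e2, ← hMdef]
    field_simp
    ring
  refine ⟨M, m, σ, β, P, hM, hM0, hm, hσ, hβ, hβ0, hc, hPK, fun b => ?_, ?_, ?_, ?_, ?_⟩
  · have : Y (b + 1) = Y b + v b := Finset.sum_range_succ _ _
    simp only [hP, this, map_add, hv, map_smul]
    module
  -- Each term is nonnegative as `P b ∈ K`, and both totals are 1. Hence every term vanishes and the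
  -- edges lie in their facets.
  · have hzero : ∑ b ∈ Finset.range m, (β b * h (σ b) - inner ℝ (P b) (v b)) = 0 := by
      rw [Finset.sum_sub_distrib, hsum, hc, sub_self]
    rw [Finset.sum_eq_zero_iff_of_nonneg fun b hb => sub_nonneg.2
      (hvK b _ (hPK b (Finset.mem_range.1 hb).le))] at hzero
    intro b hb
    have := hzero b (Finset.mem_range.2 hb)
    rw [hv, inner_smul_right, ← mul_sub] at this
    rcases mul_eq_zero.1 this with h1 | h1
    · exact absurd h1 (hβ0 b hb).ne'
    · linarith
  · refine Submodule.smul_mem _ _ (Submodule.add_mem _ (Submodule.sub_mem _ ?_ ?_) ha)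
    · simp [hY]
    · exact Submodule.smul_mem _ _ hcoiso
  · exact Submodule.smul_mem _ _ (Submodule.add_mem _ (Submodule.sub_mem _ hcoiso
      (Submodule.smul_mem _ _ hcoiso)) ha)
  · have : P 0 - P m = (-(1 / (2 * M))) • cplxJ (Y m) := by
      simp only [hP, hY, Finset.range_zero, Finset.sum_empty, map_zero]
      module
    rw [this]
    exact Submodule.smul_mem _ _ hleaf

end ExtremalPolygon

/-! ### The parametrized extremal polygon and its properties. -/

namespace IsExtremalPolygon

variable {ι : Type*} {K : Set (PhaseSpace n)} {ν : ι → PhaseSpace n} {h : ι → ℝ} {k : ℕ}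
  {M : ℝ} {m : ℕ} {σ : ℕ → ι} {β : ℕ → ℝ} {P : ℕ → PhaseSpace n}

/-- The times at which the parametrized extremal polygon passes its vertices. -/
def time (h : ι → ℝ) (σ : ℕ → ι) (β : ℕ → ℝ) (b : ℕ) : ℝ :=
  ∑ a ∈ Finset.range b, β a * h (σ a)

/-- The velocities of the parametrized extremal polygon. -/
def velocity (ν : ι → PhaseSpace n) (h : ι → ℝ) (M : ℝ) (σ : ℕ → ι) (b : ℕ) : PhaseSpace n :=
  (1 / (2 * M * h (σ b))) • cplxJ (ν (σ b))

/-- The extremal polygon, parametrized by `[0, 1]`. -/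
def path (ν : ι → PhaseSpace n) (h : ι → ℝ) (M : ℝ) (m : ℕ) (σ : ℕ → ι) (β : ℕ → ℝ)
    (P : ℕ → PhaseSpace n) : ℝ → PhaseSpace n :=
  polygonalPath (P 0) (velocity ν h M σ) (time h σ β) m

theorem time_zero : time h σ β 0 = 0 := Finset.sum_range_zero _

theorem time_succ_sub (b : ℕ) : time h σ β (b + 1) - time h σ β b = β b * h (σ b) := by
  rw [time, time, Finset.sum_range_succ, add_sub_cancel_left]

theorem time_last (hP : IsExtremalPolygon K ν h k M m σ β P) : time h σ β m = 1 := hP.sum_weight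

theorem monotone_time (hP : IsExtremalPolygon K ν h k M m σ β P) (hrep : IsHalfspaceRep K ν h) :
    Monotone (time h σ β) :=
  monotone_nat_of_le_succ fun b => by
    have := mul_nonneg (hP.weight_nonneg b) (hrep.pos (σ b)).le
    linarith [time_succ_sub (h := h) (σ := σ) (β := β) b]

theorem time_lt_succ (hP : IsExtremalPolygon K ν h k M m σ β P) (hrep : IsHalfspaceRep K ν h)
    {b : ℕ} (hb : b < m) : time h σ β b < time h σ β (b + 1) := by
  have := mul_pos (hP.weight_pos b hb) (hrep.pos (σ b))
  linarith [time_succ_sub (h := h) (σ := σ) (β := β) b]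

theorem Icc_time_subset (hP : IsExtremalPolygon K ν h k M m σ β P) (hrep : IsHalfspaceRep K ν h)
    {b : ℕ} (hb : b < m) : Icc (time h σ β b) (time h σ β (b + 1)) ⊆ Icc 0 1 := by
  refine Icc_subset_Icc ?_ ?_
  · rw [← time_zero (h := h) (σ := σ) (β := β)]
    exact hP.monotone_time hrep b.zero_le
  · rw [← hP.time_last]
    exact hP.monotone_time hrep hb

theorem exists_mem_Icc (hP : IsExtremalPolygon K ν h k M m σ β P) (hrep : IsHalfspaceRep K ν h)
    {t : ℝ} (ht : t ∈ Icc 0 1) :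
    ∃ b < m, t ∈ Icc (time h σ β b) (time h σ β (b + 1)) := by
  rcases ht.2.eq_or_lt with rfl | h1
  · obtain ⟨b, rfl⟩ := Nat.exists_eq_succ_of_ne_zero hP.length_pos.ne'
    rw [← hP.time_last]
    exact ⟨b, b.lt_succ_self, right_mem_Icc.2 (hP.time_lt_succ hrep b.lt_succ_self).le⟩
  · obtain ⟨b, hb, htb⟩ := exists_mem_Ico_of_mem (τ := time h σ β) (m := m) (t := t)
      (by rw [time_zero]; exact ht.1) (by rwa [hP.time_last])
    exact ⟨b, hb, Ico_subset_Icc_self htb⟩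

/-- Time `β h` at speed `1 / (2 M h)` covers an edge of length factor `β / (2 M)`. This speed makes
the action integrand constant. -/
theorem vertex_eq (hP : IsExtremalPolygon K ν h k M m σ β P) (hrep : IsHalfspaceRep K ν h)
    (b : ℕ) : P 0 + ∑ a ∈ Finset.range b,
      (time h σ β (a + 1) - time h σ β a) • velocity ν h M σ a = P b := by
  induction b with
  | zero => simp
  | succ b ih =>
    have h1 := hP.pos.ne'
    have h2 := (hrep.pos (σ b)).ne'
    rw [Finset.sum_range_succ, ← add_assoc, ih, hP.vertex_succ, time_succ_sub, velocity, smul_smul]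
    congr 2
    field_simp

theorem path_eq (hP : IsExtremalPolygon K ν h k M m σ β P) (hrep : IsHalfspaceRep K ν h)
    {b : ℕ} (hb : b < m) {t : ℝ} (ht : t ∈ Icc (time h σ β b) (time h σ β (b + 1))) :
    path ν h M m σ β P t = P b + (t - time h σ β b) • velocity ν h M σ b := by
  rw [path, polygonalPath_eq (hP.monotone_time hrep) hb ht, hP.vertex_eq hrep]

theorem path_zero (hP : IsExtremalPolygon K ν h k M m σ β P) (hrep : IsHalfspaceRep K ν h) :
    path ν h M m σ β P 0 = P 0 := by
  have h0 := time_zero (h := h) (σ := σ) (β := β)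
  rw [hP.path_eq hrep hP.length_pos (t := 0), h0, sub_zero, zero_smul, add_zero]
  exact ⟨h0.le, by rw [← h0]; exact hP.monotone_time hrep (Nat.zero_le _)⟩

theorem path_one (hP : IsExtremalPolygon K ν h k M m σ β P) (hrep : IsHalfspaceRep K ν h) :
    path ν h M m σ β P 1 = P m := by
  rw [← hP.time_last, path, polygonalPath_vertex (hP.monotone_time hrep), hP.vertex_eq hrep]

/-- `⟨Jν, ν⟩ = 0`, so motion along `Jν` stays in the supporting hyperplane of `ν`. -/
theorem inner_path (hP : IsExtremalPolygon K ν h k M m σ β P) (hrep : IsHalfspaceRep K ν h)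
    {b : ℕ} (hb : b < m) {t : ℝ} (ht : t ∈ Icc (time h σ β b) (time h σ β (b + 1))) :
    inner ℝ (path ν h M m σ β P t) (ν (σ b)) = h (σ b) := by
  rw [hP.path_eq hrep hb ht, inner_add_left, hP.inner_eq b hb, velocity, inner_smul_left,
    inner_smul_left, real_inner_comm, inner_cplxJ_self, mul_zero, mul_zero, add_zero]

theorem path_mem (hP : IsExtremalPolygon K ν h k M m σ β P) (hrep : IsHalfspaceRep K ν h)
    {t : ℝ} (ht : t ∈ Icc 0 1) : path ν h M m σ β P t ∈ K := by
  obtain ⟨b, hb, htb⟩ := hP.exists_mem_Icc hrep ht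
  rw [hrep.mem_iff]
  intro i
  have h1 := (hrep.mem_iff _).1 (hP.mem b hb.le) i
  have h2 := (hrep.mem_iff _).1 (hP.mem (b + 1) hb) i
  rw [← hP.vertex_eq hrep (b + 1), Finset.sum_range_succ, ← add_assoc, hP.vertex_eq hrep,
    inner_add_left, inner_smul_left] at h2
  rw [hP.path_eq hrep hb htb, inner_add_left, inner_smul_left]
  simp only [conj_trivial] at h2 ⊢
  have h3 := htb.1
  have h4 := htb.2
  rcases le_total 0 (inner ℝ (velocity ν h M σ b) (ν i)) with hs | hs <;> nlinarith

theorem path_mem_frontier (hP : IsExtremalPolygon K ν h k M m σ β P)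
    (hrep : IsHalfspaceRep K ν h) {t : ℝ} (ht : t ∈ Icc 0 1) :
    path ν h M m σ β P t ∈ frontier K := by
  refine ⟨subset_closure (hP.path_mem hrep ht), fun hint => ?_⟩
  obtain ⟨b, hb, htb⟩ := hP.exists_mem_Icc hrep ht
  have heq := hP.inner_path hrep hb htb
  set x := path ν h M m σ β P t
  have hc : Continuous fun s : ℝ => x + s • ν (σ b) := by fun_prop
  have hev : ∀ᶠ s : ℝ in nhdsWithin 0 (Ioi 0), x + s • ν (σ b) ∈ K := by
    refine Filter.Eventually.filter_mono nhdsWithin_le_nhds ?_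
    refine hc.continuousAt.eventually ?_
    simp only [zero_smul, add_zero]
    exact mem_interior_iff_mem_nhds.1 hint
  obtain ⟨s, hs, hs0⟩ := (hev.and self_mem_nhdsWithin).exists
  have h1 := (hrep.mem_iff _).1 hs (σ b)
  have hν : ν (σ b) ≠ 0 := by
    intro h0
    rw [h0, inner_zero_right] at heq
    exact (hrep.pos _).ne heq
  rw [inner_add_left, inner_smul_left, heq] at h1
  have := mul_pos (mem_Ioi.1 hs0) (real_inner_self_pos.2 hν)
  simp only [conj_trivial] at h1
  linarith

theorem hasDerivWithinAt_path (hP : IsExtremalPolygon K ν h k M m σ β P)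
    (hrep : IsHalfspaceRep K ν h) {b : ℕ} (hb : b < m) {t : ℝ}
    (ht : t ∈ Icc (time h σ β b) (time h σ β (b + 1))) :
    HasDerivWithinAt (path ν h M m σ β P) (velocity ν h M σ b)
      (Icc (time h σ β b) (time h σ β (b + 1))) t :=
  hasDerivWithinAt_polygonalPath (hP.monotone_time hrep) hb ht

theorem hasDerivAt_path (hP : IsExtremalPolygon K ν h k M m σ β P)
    (hrep : IsHalfspaceRep K ν h) {b : ℕ} (hb : b < m) {t : ℝ}
    (ht : t ∈ Ioo (time h σ β b) (time h σ β (b + 1))) :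
    HasDerivAt (path ν h M m σ β P) (velocity ν h M σ b) t :=
  hasDerivAt_polygonalPath (hP.monotone_time hrep) hb ht

theorem ae_mem_Ioo (hP : IsExtremalPolygon K ν h k M m σ β P) :
    ∀ᵐ t ∂(volume.restrict (Icc 0 1)), ∃ b < m, t ∈ Ioo (time h σ β b) (time h σ β (b + 1)) := by
  have := ae_exists_mem_Ioo (time h σ β) m
  rwa [time_zero, hP.time_last] at this

theorem isGLC_path (hP : IsExtremalPolygon K ν h k M m σ β P) (hrep : IsHalfspaceRep K ν h) :
    IsGLC K k 1 (path ν h M m σ β P) where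
  pos := one_pos
  absCont := absolutelyContinuousOnInterval_polygonalPath _ _ _ _ _ _
  nonconstant := by
    have hm := hP.length_pos
    have hlt := hP.time_lt_succ hrep hm
    refine ⟨_, hP.Icc_time_subset hrep hm (left_mem_Icc.2 hlt.le), _,
      hP.Icc_time_subset hrep hm (right_mem_Icc.2 hlt.le), fun heq => ?_⟩
    rw [hP.path_eq hrep hm (left_mem_Icc.2 hlt.le), hP.path_eq hrep hm (right_mem_Icc.2 hlt.le),
      sub_self, zero_smul, add_right_inj] at heq
    rcases smul_eq_zero.1 heq.symm with h1 | h1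
    · linarith
    · have h2 : cplxJ (ν (σ 0)) = 0 := by
        rcases smul_eq_zero.1 h1 with h2 | h2
        · have := hP.pos
          have := hrep.pos (σ 0)
          exact absurd h2 (by positivity)
        · exact h2
      have h3 := hP.inner_eq 0 hm
      rw [← inner_cplxJ_cplxJ, h2, inner_zero_right] at h3
      exact (hrep.pos _).ne h3
  mem_boundary t ht := hP.path_mem_frontier hrep ht
  velocity := by
    filter_upwards [hP.ae_mem_Ioo] with t ⟨b, hb, ht⟩
    refine ⟨(1 / (2 * M * h (σ b))) • ν (σ b), fun u hu => ?_, ?_⟩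
    · have h1 := hP.inner_path hrep hb (Ioo_subset_Icc_self ht)
      have h2 := (hrep.mem_iff u).1 hu (σ b)
      have := hP.pos
      have := hrep.pos (σ b)
      rw [inner_smul_right, inner_sub_left, h1]
      exact mul_nonpos_of_nonneg_of_nonpos (by positivity) (by linarith)
    · rw [map_smul]
      exact hP.hasDerivAt_path hrep hb ht
  start_mem := by rw [hP.path_zero hrep]; exact hP.start_mem
  end_mem := by rw [hP.path_one hrep]; exact hP.end_mem
  leaf := by rw [hP.path_zero hrep, hP.path_one hrep]; exact hP.leaf

/-- On each edge the integrand is `h / (2 M h) = 1 / (2 M)`. -/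
theorem action_path (hP : IsExtremalPolygon K ν h k M m σ β P) (hrep : IsHalfspaceRep K ν h) :
    action 1 (path ν h M m σ β P) = 1 / (4 * M) := by
  have hM := hP.pos
  have : ∫ t in (0 : ℝ)..1, inner ℝ (-(cplxJ (deriv (path ν h M m σ β P) t)))
      (path ν h M m σ β P t) = ∫ _t in (0 : ℝ)..1, 1 / (2 * M) := by
    refine intervalIntegral.integral_congr_ae_restrict ?_
    rw [uIoc_of_le zero_le_one]
    filter_upwards [ae_restrict_of_ae_restrict_of_subset Ioc_subset_Icc_self hP.ae_mem_Ioo]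
      with t ⟨b, hb, ht⟩
    have hb0 := hrep.pos (σ b)
    rw [(hP.hasDerivAt_path hrep hb ht).deriv, velocity, map_smul, cplxJ_cplxJ, smul_neg, neg_neg,
      inner_smul_left, real_inner_comm, hP.inner_path hrep hb (Ioo_subset_Icc_self ht)]
    simp only [conj_trivial]
    field_simp
  rw [action, this, intervalIntegral.integral_const]
  simp only [sub_zero, one_smul]
  field_simp
  norm_num

theorem eq_of_velocity_eq (hP : IsExtremalPolygon K ν h k M m σ β P)
    (hrep : IsHalfspaceRep K ν h) (hunit : ∀ i, ‖ν i‖ = 1) (hinj : Function.Injective ν)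
    {b : ℕ} {i : ι} {C : ℝ} (hC : 0 < C) (heq : velocity ν h M σ b = C • cplxJ (ν i)) :
    σ b = i := by
  have hM := hP.pos
  have hb := hrep.pos (σ b)
  set c := 1 / (2 * M * h (σ b)) with hc
  have hc0 : 0 < c := by positivity
  have h1 : c • ν (σ b) = C • ν i := by
    have := congrArg cplxJ heq
    rw [velocity, map_smul, map_smul, cplxJ_cplxJ, cplxJ_cplxJ, smul_neg, smul_neg, neg_inj] at this
    exact this
  have h2 : c = C := by
    have := congrArg norm h1
    rwa [norm_smul, norm_smul, hunit, hunit, mul_one, mul_one, Real.norm_of_nonneg hc0.le,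
      Real.norm_of_nonneg hC.le] at this
  rw [h2] at h1
  exact hinj (smul_right_injective _ hC.ne' h1)

/-- At a vertex too, a derivative within `[0, 1]` restricts to the derivative along each adjacent
edge, where it is unique. -/
theorem eq_of_hasDerivWithinAt (hP : IsExtremalPolygon K ν h k M m σ β P)
    (hrep : IsHalfspaceRep K ν h) (hunit : ∀ i, ‖ν i‖ = 1) (hinj : Function.Injective ν)
    {b : ℕ} (hb : b < m) {t : ℝ} (ht : t ∈ Icc (time h σ β b) (time h σ β (b + 1)))
    {i : ι} {C : ℝ} (hC : 0 < C)
    (hd : HasDerivWithinAt (path ν h M m σ β P) (C • cplxJ (ν i)) (Icc 0 1) t) : σ b = i :=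
  hP.eq_of_velocity_eq hrep hunit hinj hC
    ((uniqueDiffOn_Icc (hP.time_lt_succ hrep hb) t ht).eq_deriv _ (hP.hasDerivWithinAt_path hrep hb ht)
      (hd.mono (hP.Icc_time_subset hrep hb)))

/-- As `σ` is injective, a single edge has the given direction; the set lies between its open time
interval and the closure of that interval. -/
theorem isPreconnected_direction (hP : IsExtremalPolygon K ν h k M m σ β P)
    (hrep : IsHalfspaceRep K ν h) (hunit : ∀ i, ‖ν i‖ = 1) (hinj : Function.Injective ν) (i : ι) :
    IsPreconnected {t : ℝ | t ∈ Icc (0 : ℝ) 1 ∧ ∃ C : ℝ, 0 < C ∧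
      HasDerivWithinAt (path ν h M m σ β P) (C • cplxJ (ν i)) (Icc 0 1) t} := by
  by_cases hi : ∃ b < m, σ b = i
  · obtain ⟨b, hb, rfl⟩ := hi
    have hM := hP.pos
    have hpos := hrep.pos (σ b)
    refine isPreconnected_Ioo.subset_closure (s := Ioo (time h σ β b) (time h σ β (b + 1)))
      (fun t ht => ⟨hP.Icc_time_subset hrep hb (Ioo_subset_Icc_self ht), _,
        by positivity, (hP.hasDerivAt_path hrep hb ht).hasDerivWithinAt⟩) ?_
    rw [closure_Ioo (hP.time_lt_succ hrep hb).ne]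
    rintro t ⟨ht, C, hC, hd⟩
    obtain ⟨b', hb', ht'⟩ := hP.exists_mem_Icc hrep ht
    have := hP.injOn hb' hb (hP.eq_of_hasDerivWithinAt hrep hunit hinj hb' ht' hC hd)
    rwa [this] at ht'
  · convert! isPreconnected_empty using 1
    rw [eq_empty_iff_forall_notMem]
    rintro t ⟨ht, C, hC, hd⟩
    obtain ⟨b', hb', ht'⟩ := hP.exists_mem_Icc hrep ht
    exact hi ⟨b', hb', hP.eq_of_hasDerivWithinAt hrep hunit hinj hb' ht' hC hd⟩

/-- Every edge lies in the hyperplane of its own normal, so only the edge with normal `ν i` can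
satisfy the strict inequalities. On it they are affine in `t` and cut out a convex set. -/
theorem isPreconnected_inner_lt (hP : IsExtremalPolygon K ν h k M m σ β P)
    (hrep : IsHalfspaceRep K ν h) (i : ι) :
    IsPreconnected {t : ℝ | t ∈ Icc (0 : ℝ) 1 ∧ inner ℝ (path ν h M m σ β P t) (ν i) = h i ∧
      ∀ l, l ≠ i → inner ℝ (path ν h M m σ β P t) (ν l) < h l} := by
  have key : ∀ t ∈ Icc (0 : ℝ) 1, (∀ l, l ≠ i → inner ℝ (path ν h M m σ β P t) (ν l) < h l) →
      ∀ b < m, t ∈ Icc (time h σ β b) (time h σ β (b + 1)) → σ b = i := by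
    intro t _ hl b hb htb
    by_contra hne
    exact (hl _ hne).ne (hP.inner_path hrep hb htb)
  by_cases hi : ∃ b < m, σ b = i
  · obtain ⟨b, hb, rfl⟩ := hi
    have hset : {t : ℝ | t ∈ Icc (0 : ℝ) 1 ∧
        inner ℝ (path ν h M m σ β P t) (ν (σ b)) = h (σ b) ∧
        ∀ l, l ≠ σ b → inner ℝ (path ν h M m σ β P t) (ν l) < h l} =
        Icc (time h σ β b) (time h σ β (b + 1)) ∩ {t | ∀ l, l ≠ σ b →
          inner ℝ (P b + (t - time h σ β b) • velocity ν h M σ b) (ν l) < h l} := by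
      ext t
      constructor
      · rintro ⟨ht, -, hl⟩
        obtain ⟨b', hb', ht'⟩ := hP.exists_mem_Icc hrep ht
        have := hP.injOn hb' hb (key t ht hl b' hb' ht')
        rw [this] at ht'
        refine ⟨ht', fun l hne => ?_⟩
        rw [← hP.path_eq hrep hb ht']
        exact hl l hne
      · rintro ⟨ht, hl⟩
        refine ⟨hP.Icc_time_subset hrep hb ht, hP.inner_path hrep hb ht, fun l hne => ?_⟩
        rw [hP.path_eq hrep hb ht]
        exact hl l hne
    rw [hset]
    refine Convex.isPreconnected ((convex_Icc _ _).inter ?_)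
    intro s hs t ht a c ha hc hac l hne
    have h1 := hs l hne
    have h2 := ht l hne
    simp only [inner_add_left, inner_smul_left, conj_trivial, smul_eq_mul] at h1 h2 ⊢
    set p := inner ℝ (P b) (ν l)
    set q := inner ℝ (velocity ν h M σ b) (ν l)
    set τ := time h σ β b
    have : p + (a * s + c * t - τ) * q = a * (p + (s - τ) * q) + c * (p + (t - τ) * q) := by
      have : c = 1 - a := by linarith
      rw [this]; ring
    rw [this]
    rcases ha.eq_or_lt with rfl | ha'
    · rw [zero_add] at hac
      rw [hac]
      linarith
    · calc a * (p + (s - τ) * q) + c * (p + (t - τ) * q) < a * h l + c * h l :=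
          add_lt_add_of_lt_of_le (mul_lt_mul_of_pos_left h1 ha')
            (mul_le_mul_of_nonneg_left h2.le hc)
        _ = h l := by rw [← add_mul, hac, one_mul]
  · convert! isPreconnected_empty using 1
    rw [eq_empty_iff_forall_notMem]
    rintro t ⟨ht, -, hl⟩
    obtain ⟨b', hb', ht'⟩ := hP.exists_mem_Icc hrep ht
    exact hi ⟨b', hb', key t ht hl b' hb' ht'⟩

theorem encard_discontinuity_le [Fintype ι] (hP : IsExtremalPolygon K ν h k M m σ β P)
    (hrep : IsHalfspaceRep K ν h) :
    {t : ℝ | t ∈ Icc (0 : ℝ) 1 ∧ ¬ (DifferentiableWithinAt ℝ (path ν h M m σ β P) (Icc 0 1) t ∧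
      ContinuousWithinAt (derivWithin (path ν h M m σ β P) (Icc 0 1)) (Icc 0 1) t)}.encard ≤
      Fintype.card ι := by
  classical
  have hcard : m ≤ Fintype.card ι := by
    have := Finset.card_le_card_of_injOn (s := Finset.range m) (t := (Finset.univ : Finset ι)) σ
      (fun _ _ => Finset.mem_univ _) (hP.injOn.mono fun b hb => by simpa using hb)
    simpa using this
  -- Time 0 is left out: within `[0, 1]` the velocity is constant near 0. This keeps the count at
  -- `m` rather than `m + 1`.
  set S : Finset ℝ := (Finset.range m).image fun b => time h σ β (b + 1) with hS
  have hScard : S.card ≤ m := Finset.card_image_le.trans (Finset.card_range m).le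
  refine (encard_le_encard (t := (S : Set ℝ)) ?_).trans ?_
  · rintro t ⟨ht, hbad⟩
    by_contra htS
    have hne : ∀ b < m, t ≠ time h σ β (b + 1) := fun b hb h =>
      htS (Finset.mem_coe.2 (Finset.mem_image.2 ⟨b, Finset.mem_range.2 hb, h.symm⟩))
    obtain ⟨b, hb, htb⟩ := hP.exists_mem_Icc hrep ht
    have hlt := lt_of_le_of_ne htb.2 (hne b hb)
    have hnhds : Icc (time h σ β b) (time h σ β (b + 1)) ∈ nhdsWithin t (Icc 0 1) := by
      rcases Nat.eq_zero_or_pos b with rfl | hb0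
      · filter_upwards [self_mem_nhdsWithin, nhdsWithin_le_nhds (Iio_mem_nhds hlt)] with s hs hs'
        exact ⟨by rw [time_zero]; exact hs.1, le_of_lt hs'⟩
      · refine nhdsWithin_le_nhds (Icc_mem_nhds (lt_of_le_of_ne htb.1 ?_) hlt)
        obtain ⟨b, rfl⟩ := Nat.exists_eq_succ_of_ne_zero hb0.ne'
        exact (hne b (by omega)).symm
    have hderiv : ∀ s ∈ Icc (0 : ℝ) 1,
        Icc (time h σ β b) (time h σ β (b + 1)) ∈ nhdsWithin s (Icc 0 1) →
        HasDerivWithinAt (path ν h M m σ β P) (velocity ν h M σ b) (Icc 0 1) s := fun s hs hmem =>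
      (hP.hasDerivWithinAt_path hrep hb (mem_of_mem_nhdsWithin hs hmem)).mono_of_mem_nhdsWithin hmem
    refine hbad ⟨(hderiv t ht hnhds).differentiableWithinAt, ?_⟩
    have hev : ∀ᶠ s in nhdsWithin t (Icc 0 1),
        derivWithin (path ν h M m σ β P) (Icc 0 1) s = velocity ν h M σ b := by
      filter_upwards [eventually_eventually_nhdsWithin.2 hnhds, self_mem_nhdsWithin] with s hs hs'
      exact (hderiv s hs' hs).derivWithin (uniqueDiffOn_Icc zero_lt_one s hs')
    exact continuousWithinAt_const.congr_of_eventuallyEq hev (hev.self_of_nhdsWithin ht)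
  · rw [encard_coe_eq_coe_finsetCard]
    exact_mod_cast hScard.trans hcard

end IsExtremalPolygon

end LeafwiseChord

end

/-! ### The main theorem. -/

open LeafwiseChord LeafwiseChord.IsExtremalPolygon in
theorem theorem5p1 {n k : ℕ} (hk : k < n)
    (K : Set (LeafwiseChord.PhaseSpace n))
    (hK : LeafwiseChord.IsConvexPolytope K) (h0 : (0 : LeafwiseChord.PhaseSpace n) ∈ interior K)
    -- the facets of `K`, listed without repetition, and their outer unit normals
    {N : ℕ} (F : Fin N → Set (LeafwiseChord.PhaseSpace n)) (hFinj : Function.Injective F)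
    (hF : ∀ G : Set (LeafwiseChord.PhaseSpace n), LeafwiseChord.IsFacet K G ↔ ∃ i, F i = G)
    (ν : Fin N → LeafwiseChord.PhaseSpace n)
    (hν : ∀ i, LeafwiseChord.IsOuterUnitNormal K (F i) (ν i)) :
    ∃ γ : ℝ → LeafwiseChord.PhaseSpace n,
      LeafwiseChord.IsGLC K k 1 γ ∧
      IsLeast {a : ℝ | ∃ (T : ℝ) (z : ℝ → LeafwiseChord.PhaseSpace n),
        LeafwiseChord.IsGLC K k T z ∧ LeafwiseChord.action T z = a} (LeafwiseChord.action 1 γ) ∧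
      -- the velocity is piecewise constant, with pieces in the directions `J νᵢ`
      (∃ (m : ℕ) (w : Fin m → LeafwiseChord.PhaseSpace n) (τ : Fin (m + 1) → ℝ),
        StrictMono τ ∧ τ 0 = 0 ∧ τ (Fin.last m) = 1 ∧
        (∀ j : Fin m, ∀ t ∈ Set.Ioo (τ j.castSucc) (τ j.succ), HasDerivAt γ (w j) t) ∧
        (∀ j : Fin m, ∃ i : Fin N, ∃ C : ℝ, 0 < C ∧ w j = C • LeafwiseChord.cplxJ (ν i)) ∧
        -- every facet direction is used on at most one piece
        (∀ i : Fin N, ∀ j j' : Fin m,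
          (∃ C : ℝ, 0 < C ∧ w j = C • LeafwiseChord.cplxJ (ν i)) →
          (∃ C : ℝ, 0 < C ∧ w j' = C • LeafwiseChord.cplxJ (ν i)) → j = j')) ∧
      -- the set of times at which a facet direction is used is connected (possibly empty)
      (∀ i : Fin N, IsPreconnected {t : ℝ | t ∈ Set.Icc (0 : ℝ) 1 ∧ ∃ C : ℝ, 0 < C ∧
        HasDerivWithinAt γ (C • LeafwiseChord.cplxJ (ν i)) (Set.Icc 0 1) t}) ∧
      -- the velocity has at most `N` points of discontinuity
      {t : ℝ | t ∈ Set.Icc (0 : ℝ) 1 ∧ ¬ (DifferentiableWithinAt ℝ γ (Set.Icc 0 1) t ∧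
        ContinuousWithinAt (derivWithin γ (Set.Icc 0 1)) (Set.Icc 0 1) t)}.encard ≤ N ∧
      -- the interior of each facet is visited at most once
      (∀ i : Fin N, IsPreconnected {t : ℝ | t ∈ Set.Icc (0 : ℝ) 1 ∧
        γ t ∈ intrinsicInterior ℝ (F i)}) := by
  have hn : 0 < n := (Nat.zero_le k).trans_lt hk
  obtain ⟨h, hrep, hmem⟩ := exists_isHalfspaceRep hK h0 hF hν
  have hFi : ∀ i, IsFacet K (F i) := fun i => (hF _).2 ⟨i, rfl⟩
  have hinj := injective_normal hFinj hrep hFi hν hmem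
  have hunit : ∀ i, ‖ν i‖ = 1 := fun i => (hν i).1
  obtain ⟨M, m, σ, β, P, hM, hP⟩ := hrep.exists_extremal_polygon hn h0 k
  have hM0 := hP.pos
  refine ⟨path ν h M m σ β P, hP.isGLC_path hrep,
    ⟨⟨1, _, hP.isGLC_path hrep, rfl⟩, ?_⟩, ⟨m, fun j => velocity ν h M σ j,
      fun j => time h σ β j, ?_, time_zero, hP.time_last, ?_, ?_, ?_⟩,
    hP.isPreconnected_direction hrep hunit hinj, ?_, fun i => ?_⟩
  · rintro _ ⟨T, z, hz, rfl⟩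
    rw [hP.action_path hrep]
    exact hz.le_action h0 hM hM0
  · rw [Fin.strictMono_iff_lt_succ]
    exact fun j => hP.time_lt_succ hrep j.2
  · exact fun j t ht => hP.hasDerivAt_path hrep j.2 ht
  · intro j
    have := hrep.pos (σ j)
    exact ⟨σ j, _, by positivity, rfl⟩
  · rintro i j j' ⟨C, hC, hj⟩ ⟨C', hC', hj'⟩
    exact Fin.ext (hP.injOn j.2 j'.2 ((hP.eq_of_velocity_eq hrep hunit hinj hC hj).trans
      (hP.eq_of_velocity_eq hrep hunit hinj hC' hj').symm))
  · simpa using hP.encard_discontinuity_le hrep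
  · simp only [mem_intrinsicInterior_facet_iff hFinj hrep hFi hν hmem]
    exact hP.isPreconnected_inner_lt hrep i
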